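/- **Channel.** The symmetric linear deterministic interference relay channel (LD-IRC) has integer strengths $n_d,n_c,n_r,n_s\ge 0$; put $q=\max\{n_d,n_c,n_r,n_s\}$ and let $S$ be the $q\times q$ down-shift matrix over $\mathbb F_2$. In channel use $k$ the transmitters send $x_1[k],x_2[k]\in\mathbb F_2^q$, the relay sends $x_r[k]\in\mathbb F_2^q$, a function of $y_r[1],\dots,y_r[k-1]$ with $x_r[1]=0$, and the outputs are $$y_r[k]=S^{q-n_s}(x_1[k]\oplus x_2[k]),\qquad y_j[k]=S^{q-n_d}x_j[k]\oplus S^{q-n_c}x_l[k]\oplus S^{q-n_r}x_r[k]\quad(\{j,l\}=\{1,2\}).$$ A rate pair $(R_1,R_2)$, $R_i\ge0$, is achievable if there are codes of every length $n$ with independent uniform messages $w_i\in\{1,\dots,\lfloor 2^{nR_i}\rfloor\}$ whose average probability of the event that some receiver $i$ decodes $w_i$ incorrectly tends to $0$ as $n\to\infty$. A sum-rate $R$ is achieved if for every $\varepsilon>0$ an achievable pair has $R_1+R_2>R-\varepsilon$. **Scheme WI-2.** Fix a block length $T\ge1$ and nonnegative integers $R_{cm},R_{cn},R_{cf},R_{p1},R_{p2}$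 (bits per block). A block of $T$ channel uses is regarded as one use of an LD-IRC with strengths $n_a'=Tn_a$ for $a\in\{d,c,r,s\}$; $N=\lfloor n/T\rfloor$ blocks are used. In block $k$, transmitter $i$ sends, from the top level down, $$\big(u_{i,cm}[k],\;u_{i,cn}[k-1],\;u_{i,cf}[k],\;0_{\ell_1},\;u_{i,p1}[k],\;u_{i,cn}[k],\;u_{i,p2}[k]\big),$$ where the common signal $u_{i,cm}$ has length $2R_{cm}$, depends only on a common part of $w_i$ taking at most $2^{N\min\{R_{cm},(n_c'-n_d'+2R_{cm})^+\}}$ values, and the neutralization, compute-forward and private signals $u_{i,cn},u_{i,cf},u_{i,p1},u_{i,p2}$ are functions of $w_i$ of lengths $R_{cn},R_{cf},R_{p1},R_{p2}$; $u_{i,cn}$ is zero in block $0$ and all signals are zero in block $N$. The relay sends in block $k$ (in positions from the top, completed by zeros) $$\big(0_{\ell_2},\,(u_{r,cf}[k])_{[1:\ell_4]},\,0_{\ell_3},\,(u_{r,cf}[k])_{[\ell_4+1:R_{cf}]}\big)\oplus\big(0_{\ell_5},\,(u_{r,cn}[k])_{[1:\ell_6]}\big),\qquad u_{r,a}[k]=u_{1,a}[k-1]\oplus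 u_{2,a}[k-1].$$ Here $\ell_1=n_d'-2R_{cm}-2R_{cn}-R_{cf}-R_{p1}-R_{p2}$, $\ell_4=(R_{cf}-R_{cn})^+$, $\ell_5=n_r'-n_c'+2R_{cm}$, $\ell_6=\min\{R_{cn},(n_c'-2R_{cm})^+\}$; $\ell_3=R_{p1}$ if $\ell_4>0$ and $\ell_3=0$ otherwise; and $\ell_2$ equals $(n_r'-n_d'+2R_{cm}+R_{cn}+R_{cf})^+$ if $\ell_4>0$, $(n_r'-n_d'+2R_{cm}+R_{cn}+R_{cf}+\ell_1+R_{p1})^+$ if $\ell_4=0<R_{cf}$, and $n_r'$ if $R_{cf}=0$. The parameters are feasible if $\ell_1\ge\ell_4$, $2R_{cm}+2R_{cn}+R_{cf}+\ell_1+R_{p1}\le n_s'$, $\ell_2+R_{cf}+\ell_3\le n_r'$, $\ell_5+\ell_6\le n_r'$, $2R_{cm}\le n_c'$, $n_c'\le 2R_{cm}+R_{cn}+R_{cf}+\ell_1$, the transmit vector has length at most $n_d'$, and, if $R_{cf}>0$, $n_r'-\ell_2\le n_d'-2R_{cm}-R_{cn}-R_{cf}$. The scheme is reliable if each receiver recovers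 its own message and the common part of the other message with error probability tending to $0$. Its sum-rate is $\frac2T\big(\min\{R_{cm},(n_c'-n_d'+2R_{cm})^+\}+R_{cn}+R_{cf}+R_{p1}+R_{p2}\big)$. **Proposition.** Let $n_c\le n_s\le n_r\le n_d$ or $n_c\le n_r\le n_s\le n_d-\frac{n_c}2$, and put $$R_{\Sigma}=\min\{\,2n_d-n_c,\;2\max\{n_r+n_s-n_c,\;n_d-n_c\}\,\}.$$ 1. There are feasible parameters of scheme WI-2 whose sum-rate is $R_\Sigma$, and with these parameters scheme WI-2 achieves the sum-rate $R_\Sigma$: for every $\varepsilon>0$ there is $r\ge0$ with $2r>R_\Sigma-\varepsilon$ such that it communicates reliably at rates $(r,r)$. 2. $R_\Sigma$ is the smallest of the following expressions (upper bounds on the sum-capacity): - $\max\{n_d,n_c,n_r\}+\max\{n_d,n_c\}$, - $n_r+2\max\{n_d,n_c\}-n_c$, - $\max\{n_d,n_c\}+\max\{n_d,n_s\}$, - $2\max\{n_c,n_r,n_d-\max\{n_c,n_s\}\}+2(n_s-n_c)^+$, - $2\max\{n_d,n_r\}$, - $\max\{n_d,n_r,n_c\}+\max\{n_d,n_c\}-n_c+(n_s-\max\{n_d,n_c\})^+$,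 - $\max\{n_d,\min\{n_r,n_s\}\}$, only if $n_d=n_c$, - $2\max\{n_c,n_r+n_d-n_c\}$, only if $n_r\le n_c\le n_d$. 3. If $n_c<n_s$, then $R_\Sigma$ equals the sum-capacity expression $$\min\left\{\begin{array}{l}2\max\{n_d,n_r\},\\ \max\{n_d,n_c,n_r\}+\max\{n_d,n_c\}-\big(n_c-(n_s-\max\{n_d,n_c\})^+\big)^+,\\ n_r+2\max\{n_d,n_c\}-n_c,\\ 2\max\{n_s,n_r+n_s-n_c,n_d-n_c\},\\ \max\{n_d,n_c\}+\max\{n_d,n_s\},\\ 2\max\{n_c,n_r+(n_d-n_c)^+\}\end{array}\right\},$$ and this sum-rate is achieved on the LD-IRC. -/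

import Mathlib

open Filter Topology

/-- The symmetric linear deterministic interference relay channel (LD-IRC), given by its channel
strengths: direct link, cross link, relay-destination link and source-relay link. -/
structure LDIRC where
  nd : ℕ
  nc : ℕ
  nr : ℕ
  ns : ℕ

namespace LDIRC

variable (ch : LDIRC)

/-- The length of the binary input and output vectors. -/
def q : ℕ := max (max ch.nd ch.nc) (max ch.nr ch.ns)

/-- A binary signal vector; level `0` is the top-most one. -/
abbrev Signal : Type := Fin ch.q → ZMod 2

/-- The down-shift matrix. -/
def shiftMatrix : Matrix (Fin ch.q) (Fin ch.q) (ZMod 2) :=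
  Matrix.of fun i j => if i.val = j.val + 1 then 1 else 0

/-- The part of the signal `x` seen through a link of strength `m`: `S ^ (q - m) x`. -/
def link (m : ℕ) (x : ch.Signal) : ch.Signal :=
  (ch.shiftMatrix ^ (ch.q - m)).mulVec x

/-- A code for `n` channel uses with `M₁` and `M₂` messages. In channel use `k` the relay knows
its outputs in the channel uses before `k`; it is silent in the first channel use. -/
structure Code (n M₁ M₂ : ℕ) where
  enc₁ : Fin M₁ → Fin n → ch.Signal
  enc₂ : Fin M₂ → Fin n → ch.Signal
  relay : (k : Fin n) → (Fin k.val → ch.Signal) → ch.Signal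
  relay_first : ∀ k : Fin n, k.val = 0 → ∀ y, relay k y = 0
  dec₁ : (Fin n → ch.Signal) → Fin M₁
  dec₂ : (Fin n → ch.Signal) → Fin M₂

namespace Code

variable {ch} {n M₁ M₂ : ℕ} (C : ch.Code n M₁ M₂)

/-- The output at the relay. -/
def relayOutput (w₁ : Fin M₁) (w₂ : Fin M₂) (k : Fin n) : ch.Signal :=
  ch.link ch.ns (C.enc₁ w₁ k) + ch.link ch.ns (C.enc₂ w₂ k)

/-- The signal transmitted by the relay. -/
def relaySignal (w₁ : Fin M₁) (w₂ : Fin M₂) (k : Fin n) : ch.Signal :=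
  C.relay k fun j => C.relayOutput w₁ w₂ ⟨j.val, j.isLt.trans k.isLt⟩

/-- The output at receiver 1. -/
def output₁ (w₁ : Fin M₁) (w₂ : Fin M₂) (k : Fin n) : ch.Signal :=
  ch.link ch.nd (C.enc₁ w₁ k) + ch.link ch.nc (C.enc₂ w₂ k) +
    ch.link ch.nr (C.relaySignal w₁ w₂ k)

/-- The output at receiver 2. -/
def output₂ (w₁ : Fin M₁) (w₂ : Fin M₂) (k : Fin n) : ch.Signal :=
  ch.link ch.nd (C.enc₂ w₂ k) + ch.link ch.nc (C.enc₁ w₁ k) +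
    ch.link ch.nr (C.relaySignal w₁ w₂ k)

/-- Some receiver does not recover its message. -/
def Error (w : Fin M₁ × Fin M₂) : Prop :=
  C.dec₁ (C.output₁ w.1 w.2) ≠ w.1 ∨ C.dec₂ (C.output₂ w.1 w.2) ≠ w.2

/-- The average error probability for independent uniformly distributed messages. -/
noncomputable def errorProb : ℝ :=
  (Set.ncard {w : Fin M₁ × Fin M₂ | C.Error w} : ℝ) / ((M₁ : ℝ) * (M₂ : ℝ))

end Code

/-- The size of the message set of a user of rate `R` in `n` channel uses. -/
noncomputable def numMessages (n : ℕ) (R : ℝ) : ℕ := ⌊(2 : ℝ) ^ ((n : ℝ) * R)⌋₊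

/-- Achievability of a rate pair. -/
def Achievable (R₁ R₂ : ℝ) : Prop :=
  0 ≤ R₁ ∧ 0 ≤ R₂ ∧
    ∃ C : (n : ℕ) → ch.Code n (numMessages n R₁) (numMessages n R₂),
      Tendsto (fun n => (C n).errorProb) atTop (𝓝 0)

/-- The parameters of scheme WI-2. The scheme works on blocks of `T` consecutive channel uses, and
`Rcm`, `Rcn`, `Rcf`, `Rp1`, `Rp2` are numbers of bits per block, for the common signal (which has
length `2 * Rcm`), the neutralization (CN), compute-forward (CF) and the two private signals. -/
structure WI2Params where
  T : ℕ
  Rcm : ℕ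
  Rcn : ℕ
  Rcf : ℕ
  Rp1 : ℕ
  Rp2 : ℕ

namespace WI2Params

variable (P : WI2Params) (ch : LDIRC)

/-! A block of `T` channel uses is a channel of strengths `T * nd`, `T * nc`, `T * nr`, `T * ns`.
Truncated subtraction of natural numbers is the positive part `(·)⁺` below. -/

/-- Number of zeros that complete the transmit vector. -/
def l1 : ℕ := P.T * ch.nd - (2 * P.Rcm + 2 * P.Rcn + P.Rcf + P.Rp1 + P.Rp2)

/-- Length of the first part of the CF signal of the relay. -/
def l4 : ℕ := P.Rcf - P.Rcn

/-- Number of zeros above the CF signal of the relay. -/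
def l2 : ℕ :=
  if 0 < P.l4 then P.T * ch.nr + 2 * P.Rcm + P.Rcn + P.Rcf - P.T * ch.nd
  else if 0 < P.Rcf then
    P.T * ch.nr + 2 * P.Rcm + P.Rcn + P.Rcf + P.l1 ch + P.Rp1 - P.T * ch.nd
  else P.T * ch.nr

/-- Number of zeros between the two parts of the CF signal of the relay. -/
def l3 : ℕ := if 0 < P.l4 then P.Rp1 else 0

/-- Number of zeros above the CN signal of the relay. -/
def l5 : ℕ := P.T * ch.nr + 2 * P.Rcm - P.T * ch.nc

/-- Number of CN bits that the relay sends. -/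
def l6 : ℕ := min P.Rcn (P.T * ch.nc - 2 * P.Rcm)

/-- The constraints of the scheme. -/
structure Feasible : Prop where
  T_pos : 0 < P.T
  /-- The transmit vector fits. -/
  fits : 2 * P.Rcm + 2 * P.Rcn + P.Rcf + P.l1 ch + P.Rp1 + P.Rp2 ≤ P.T * ch.nd
  /-- The relay observes the CF and CN signals. -/
  relay_observes : 2 * P.Rcm + 2 * P.Rcn + P.Rcf + P.l1 ch + P.Rp1 ≤ P.T * ch.ns
  /-- The receivers observe the CF signal of the relay. -/
  cf_observed : P.l2 ch + P.Rcf + P.l3 ≤ P.T * ch.nr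
  /-- The receivers observe the CN signal of the relay. -/
  cn_observed : P.l5 ch + P.l6 ch ≤ P.T * ch.nr
  /-- The common signal is received on levels of the cross link. -/
  common_le : 2 * P.Rcm ≤ P.T * ch.nc
  /-- The CF signal of the relay is received below the common signal, and the CN and CF signals
  of the desired transmitter. -/
  cf_below : 0 < P.Rcf →
    P.T * ch.nr + (2 * P.Rcm + P.Rcn + P.Rcf) ≤ P.T * ch.nd + P.l2 ch
  /-- The private signals and the new CN signal of the undesired transmitter are not received. -/
  private_hidden : P.T * ch.nc ≤ 2 * P.Rcm + P.Rcn + P.Rcf + P.l1 ch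
  /-- The first part of the CF signal of the relay is received on the zero levels. -/
  l4_le : P.l4 ≤ P.l1 ch

/-- The number of bits per block and user carried by the common signals,
`min {Rcm, (nc - nd + 2 Rcm)⁺}` for the channel strengths of a block. -/
def commonRate : ℕ := min P.Rcm (P.T * ch.nc + 2 * P.Rcm - P.T * ch.nd)

/-- The sum-rate per channel use of the scheme with given parameters. -/
noncomputable def sumRate : ℝ :=
  2 * ((P.commonRate ch + P.Rcn + P.Rcf + P.Rp1 + P.Rp2 : ℕ) : ℝ) / (P.T : ℝ)

/-- The signals of one transmitter with `M` messages in `N` blocks (numbered from `0`). The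
common signal depends only on the common part of the message; all signals are zero from the last
block on. -/
structure Signals (M N : ℕ) where
  Mcm : ℕ
  Mcm_le : Mcm ≤ 2 ^ (N * P.commonRate ch)
  common : Fin M → Fin Mcm
  ucm : Fin Mcm → ℕ → Fin (2 * P.Rcm) → ZMod 2
  ucn : Fin M → ℕ → Fin P.Rcn → ZMod 2
  ucf : Fin M → ℕ → Fin P.Rcf → ZMod 2
  up1 : Fin M → ℕ → Fin P.Rp1 → ZMod 2
  up2 : Fin M → ℕ → Fin P.Rp2 → ZMod 2
  ucm_last : ∀ w k, N ≤ k + 1 → ucm w k = 0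
  ucn_last : ∀ w k, N ≤ k + 1 → ucn w k = 0
  ucf_last : ∀ w k, N ≤ k + 1 → ucf w k = 0
  up1_last : ∀ w k, N ≤ k + 1 → up1 w k = 0
  up2_last : ∀ w k, N ≤ k + 1 → up2 w k = 0

/-- The vector `u[k-1]`, which is zero in the first block. -/
def prev {R : ℕ} (u : ℕ → Fin R → ZMod 2) (k : ℕ) : Fin R → ZMod 2 :=
  if k = 0 then 0 else u (k - 1)

variable {P ch}

/-- The transmit vector of a block, from the top-most level down. -/
def Signals.txVector {M N : ℕ} (s : P.Signals ch M N) (w : Fin M) (k : ℕ) : List (ZMod 2) :=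
  List.ofFn (s.ucm (s.common w) k) ++ List.ofFn (prev (s.ucn w) k) ++ List.ofFn (s.ucf w k) ++
    List.replicate (P.l1 ch) 0 ++ List.ofFn (s.up1 w k) ++ List.ofFn (s.ucn w k) ++
    List.ofFn (s.up2 w k)

/-- The part of the relay vector of a block that carries the sums of the CF signals of the
previous block. -/
def relayCF {M₁ M₂ N : ℕ} (s₁ : P.Signals ch M₁ N) (s₂ : P.Signals ch M₂ N)
    (w₁ : Fin M₁) (w₂ : Fin M₂) (k : ℕ) : List (ZMod 2) :=
  let u := List.ofFn (prev (s₁.ucf w₁) k + prev (s₂.ucf w₂) k)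
  List.replicate (P.l2 ch) 0 ++ u.take P.l4 ++ List.replicate P.l3 0 ++ u.drop P.l4

/-- The part of the relay vector of a block that carries the sums of the CN signals of the
previous block. -/
def relayCN {M₁ M₂ N : ℕ} (s₁ : P.Signals ch M₁ N) (s₂ : P.Signals ch M₂ N)
    (w₁ : Fin M₁) (w₂ : Fin M₂) (k : ℕ) : List (ZMod 2) :=
  List.replicate (P.l5 ch) 0 ++
    (List.ofFn (prev (s₁.ucn w₁) k + prev (s₂.ucn w₂) k)).take (P.l6 ch)

/-- The bit of the block vector `v` that is sent on level `i` in channel use `t`: the levels of a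
block are the pairs (level, channel use of the block), level by level from the top. -/
def bitAt (T : ℕ) (v : List (ZMod 2)) (t i : ℕ) : ZMod 2 := v.getD (i * T + t % T) 0

end WI2Params

/-- A code of scheme WI-2 with parameters `P`. Channel use `t` belongs to block `t / T`. The
receivers decode, in addition, the common message of the other user. -/
structure WI2Code (P : WI2Params) (n M₁ M₂ : ℕ) extends ch.Code n M₁ M₂ where
  s₁ : P.Signals ch M₁ (n / P.T)
  s₂ : P.Signals ch M₂ (n / P.T)
  enc₁_eq : ∀ w t i, enc₁ w t i = WI2Params.bitAt P.T (s₁.txVector w (t.val / P.T)) t.val i.val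
  enc₂_eq : ∀ w t i, enc₂ w t i = WI2Params.bitAt P.T (s₂.txVector w (t.val / P.T)) t.val i.val
  relay_eq : ∀ w₁ w₂ t i, toCode.relaySignal w₁ w₂ t i =
    WI2Params.bitAt P.T (WI2Params.relayCF s₁ s₂ w₁ w₂ (t.val / P.T)) t.val i.val +
      WI2Params.bitAt P.T (WI2Params.relayCN s₁ s₂ w₁ w₂ (t.val / P.T)) t.val i.val
  commonDec₁ : (Fin n → ch.Signal) → Fin s₂.Mcm
  commonDec₂ : (Fin n → ch.Signal) → Fin s₁.Mcm

/-- Some receiver does not recover its message or the common message of the other user. -/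
def WI2Code.SchemeError {ch : LDIRC} {P : WI2Params} {n M₁ M₂ : ℕ} (C : ch.WI2Code P n M₁ M₂)
    (w : Fin M₁ × Fin M₂) : Prop :=
  C.Error w ∨ C.commonDec₁ (C.output₁ w.1 w.2) ≠ C.s₂.common w.2 ∨
    C.commonDec₂ (C.output₂ w.1 w.2) ≠ C.s₁.common w.1

/-- The average probability of `SchemeError`. -/
noncomputable def WI2Code.schemeErrorProb {ch : LDIRC} {P : WI2Params} {n M₁ M₂ : ℕ}
    (C : ch.WI2Code P n M₁ M₂) : ℝ :=
  (Set.ncard {w : Fin M₁ × Fin M₂ | C.SchemeError w} : ℝ) / ((M₁ : ℝ) * (M₂ : ℝ))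

/-- Scheme WI-2 with parameters `P` achieves the sum-rate `R`, split equally between the users:
it communicates reliably at symmetric rate pairs with sums arbitrarily close to `R`. -/
def WI2Achieves (P : WI2Params) (R : ℝ) : Prop :=
  ∀ ε : ℝ, 0 < ε → ∃ r : ℝ, 0 ≤ r ∧ R - ε < r + r ∧
    ∃ C : (n : ℕ) → ch.WI2Code P n (numMessages n r) (numMessages n r),
      Tendsto (fun n => (C n).schemeErrorProb) atTop (𝓝 0)

/-- The sum-rate of scheme WI-2. -/
def wi2SumRate : ℤ :=
  min (2 * (ch.nd : ℤ) - ch.nc)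
    (2 * max ((ch.nr : ℤ) + ch.ns - ch.nc) ((ch.nd : ℤ) - ch.nc))

/-- The cut-set and genie-aided upper bounds on the sum-capacity that apply to the channel. -/
def sumCapacityBounds : Set ℤ :=
  {b | let nd : ℤ := ch.nd
       let nc : ℤ := ch.nc
       let nr : ℤ := ch.nr
       let ns : ℤ := ch.ns
       (nd = nc ∧ b = max nd (min nr ns)) ∨
       b = max (max nd nc) nr + max nd nc ∨
       b = nr + 2 * max nd nc - nc ∨
       b = max nd nc + max nd ns ∨
       b = 2 * max (max nc nr) (nd - max nc ns) + 2 * max (ns - nc) 0 ∨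
       ((nr ≤ nc ∧ nc ≤ nd) ∧ b = 2 * max nc (nr + nd - nc)) ∨
       b = 2 * max nd nr ∨
       b = max (max nd nr) nc + max nd nc - nc + max (ns - max nd nc) 0}

/-- The expression for the sum-capacity of the LD-IRC with `nc < ns` and `nc ≠ nd`. -/
def sumCapacityExpr : ℤ :=
  let nd : ℤ := ch.nd
  let nc : ℤ := ch.nc
  let nr : ℤ := ch.nr
  let ns : ℤ := ch.ns
  min (2 * max nd nr)
    (min (max (max nd nc) nr + max nd nc - max (nc - max (ns - max nd nc) 0) 0)
      (min (nr + 2 * max nd nc - nc)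
        (min (2 * max (max ns (nr + ns - nc)) (nd - nc))
          (min (max nd nc + max nd ns)
            (2 * max nc (nr + max (nd - nc) 0))))))

end LDIRC

/-! Both cases of the hypothesis give `nc ≤ nr, ns ≤ nd`, and these inequalities carry the whole
argument. Reliability is obtained with zero error. If the outputs at each receiver determine what it
has to decode, inverse functions serve as decoders (`exists_noError`), and the idle last block costs
a vanishing share of the rate (`wi2Achieves_of_noError`).

For `nc < nd` no common signal is needed. Blocks of two channel uses make all lengths integral,
because the rate of one user may be a half-integer. Put `e = min nc (2 (nr + ns - nd)⁺)` and `c =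
min e (2 (ns - nc))`. With `e` CF bits, `c` CN bits and private signals on the remaining free
levels, a user carries `2 (nd - nc) + e` bits per block, which is the required sum-rate since `T =
2` (`crossWeak_rate`).

Decoding runs backward over the blocks. Suppose that the desired CN signal and the sum of both CF
signals of a block are known. The relay's CN sum cancels the interfering old CN signal and leaves
the desired old CN signal in its place. The interfering CF signal is the known sum plus the desired
CF signal. Hence each interfering bit is a function of a desired bit on a strictly higher level, and
the block is decoded from the top down. The relay's CF sum falls on levels where the desired signal
is zero or already known, so it is read off too. Together with the old CN signal, it is the
knowledge required for the preceding block (`Decodable.block_decoding`,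
`Decodable.backward_decoding`).

If `nc = nd`, all four strengths are equal and both receivers see the sum of the two transmit
vectors. The users then share the levels of a block by means of common signals
(`commonOnly_achieves`). The comparison with the upper bounds is linear arithmetic over maxima and
minima. -/

namespace LDIRC

/-! ### Links as shifts of block vectors; bit lists as functions on levels -/

/-- The function `F` on the levels of a block, moved down by `d` levels. -/
def shiftDown (d : ℕ) (F : ℕ → ZMod 2) (p : ℕ) : ZMod 2 := if d ≤ p then F (p - d) else 0

theorem shiftMatrix_apply (ch : LDIRC) (i j : Fin ch.q) :
    ch.shiftMatrix i j = if i.val = j.val + 1 then 1 else 0 := rfl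

theorem shiftMatrix_pow_apply (ch : LDIRC) (k : ℕ) (i j : Fin ch.q) :
    (ch.shiftMatrix ^ k) i j = if i.val = j.val + k then 1 else 0 := by
  induction k generalizing i j with
  | zero => simp [Matrix.one_apply, Fin.ext_iff]
  | succ k ih =>
    rw [pow_succ, Matrix.mul_apply]
    simp only [ih, shiftMatrix_apply, mul_ite, mul_one, mul_zero]
    by_cases h : i.val = j.val + (k + 1)
    · have hj : j.val + 1 < ch.q := by have := i.isLt; omega
      rw [if_pos h, Finset.sum_eq_single ⟨j.val + 1, hj⟩]
      · rw [if_pos rfl, if_pos (by simp only; omega)]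
      · intro b _ hb
        have : b.val ≠ j.val + 1 := fun hb' => hb (Fin.ext hb')
        rw [if_neg this]
      · simp
    · rw [if_neg h]
      refine Finset.sum_eq_zero fun b _ => ?_
      split_ifs <;> first | rfl | omega

theorem link_apply (ch : LDIRC) (m : ℕ) (x : ch.Signal) (i : Fin ch.q) :
    ch.link m x i = if ch.q - m ≤ i.val then
      x ⟨i.val - (ch.q - m), (Nat.sub_le _ _).trans_lt i.isLt⟩ else 0 := by
  simp only [link, Matrix.mulVec, dotProduct, shiftMatrix_pow_apply, ite_mul, one_mul, zero_mul]
  split_ifs with h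
  · rw [Finset.sum_eq_single ⟨i.val - (ch.q - m), (Nat.sub_le _ _).trans_lt i.isLt⟩]
    · rw [if_pos (by simp only; omega)]
    · intro b _ hb
      rw [if_neg]
      intro h'
      exact hb (Fin.ext (by simp only; omega))
    · simp
  · refine Finset.sum_eq_zero fun b _ => ?_
    rw [if_neg (by omega)]

/-- A link of strength `m` moves a block vector down by `T * (q - m)` levels. -/
theorem link_eq_shiftDown (ch : LDIRC) (m : ℕ) {T τ : ℕ} (hτ : τ < T) (x : ch.Signal)
    (F : ℕ → ZMod 2) (hx : ∀ i, x i = F (i.val * T + τ)) (i : Fin ch.q) :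
    ch.link m x i = shiftDown (T * (ch.q - m)) F (i.val * T + τ) := by
  rw [link_apply, shiftDown]
  by_cases h : ch.q - m ≤ i.val
  · obtain ⟨d, hd⟩ := Nat.exists_eq_add_of_le h
    have h1 : i.val * T + τ = T * (ch.q - m) + (d * T + τ) := by rw [hd]; ring
    rw [if_pos h, if_pos (by omega), hx, h1, Nat.add_sub_cancel_left]
    simp only [hd, Nat.add_sub_cancel_left]
  · have h1 : (i.val + 1) * T ≤ (ch.q - m) * T := Nat.mul_le_mul_right _ (by omega)
    rw [if_neg h, if_neg]
    rw [Nat.mul_comm T]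
    rw [Nat.add_mul] at h1
    omega

/-- The entries of a list of bits, followed by zeros. -/
def bits (l : List (ZMod 2)) (p : ℕ) : ZMod 2 := l.getD p 0

theorem bits_append (l l' : List (ZMod 2)) (p : ℕ) :
    bits (l ++ l') p = if p < l.length then bits l p else bits l' (p - l.length) := by
  unfold bits
  split_ifs with h
  · exact List.getD_append _ _ _ _ h
  · exact List.getD_append_right _ _ _ _ (by omega)

theorem bits_of_length_le (l : List (ZMod 2)) {p : ℕ} (h : l.length ≤ p) : bits l p = 0 :=
  List.getD_eq_default _ _ h

theorem bits_replicate (m p : ℕ) : bits (List.replicate m 0) p = 0 := by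
  unfold bits
  rcases lt_or_ge p m with h | h
  · rw [List.getD_eq_getElem _ _ (by simpa using h), List.getElem_replicate]
  · exact List.getD_eq_default _ _ (by simpa using h)

theorem bits_take (l : List (ZMod 2)) (m p : ℕ) :
    bits (l.take m) p = if p < m then bits l p else 0 := by
  simp only [bits, List.getD_eq_getElem?_getD, List.getElem?_take]
  split_ifs <;> simp

theorem bits_drop (l : List (ZMod 2)) (m p : ℕ) : bits (l.drop m) p = bits l (m + p) := by
  simp only [bits, List.getD_eq_getElem?_getD, List.getElem?_drop]

theorem bits_ofFn {R : ℕ} (u : Fin R → ZMod 2) (p : ℕ) :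
    bits (List.ofFn u) p = if h : p < R then u ⟨p, h⟩ else 0 := by
  unfold bits
  split_ifs with h
  · rw [List.getD_eq_getElem _ _ (by simpa using h), List.getElem_ofFn]
  · exact List.getD_eq_default _ _ (by simpa using h)

theorem bits_ofFn_of_lt {R : ℕ} (u : Fin R → ZMod 2) {p : ℕ} (h : p < R) :
    bits (List.ofFn u) p = u ⟨p, h⟩ := by
  rw [bits_ofFn, dif_pos h]

theorem bits_ofFn_add {R : ℕ} (u v : Fin R → ZMod 2) (p : ℕ) :
    bits (List.ofFn (u + v)) p = bits (List.ofFn u) p + bits (List.ofFn v) p := by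
  simp only [bits_ofFn]
  split_ifs <;> simp

theorem bits_ofFn_zero {R : ℕ} (p : ℕ) :
    bits (List.ofFn (0 : Fin R → ZMod 2)) p = 0 := by
  simp [bits_ofFn]

theorem bits_ofFn_injective {R : ℕ} {u v : Fin R → ZMod 2}
    (h : ∀ p < R, bits (List.ofFn u) p = bits (List.ofFn v) p) : u = v := by
  funext j
  simpa [bits_ofFn, j.isLt] using h j.val j.isLt

/-! ### The levels of the transmit and relay vectors -/

namespace WI2Params

variable {P : WI2Params} {ch : LDIRC}

theorem bitAt_eq_bits (T : ℕ) (v : List (ZMod 2)) (t i : ℕ) :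
    bitAt T v t i = bits v (i * T + t % T) := rfl

/-- The levels of a transmit vector. -/
theorem Signals.bits_txVector {M N : ℕ} (s : P.Signals ch M N) (w : Fin M) (k p : ℕ) :
    bits (s.txVector w k) p =
      if p < 2 * P.Rcm then bits (List.ofFn (s.ucm (s.common w) k)) p
      else if p < 2 * P.Rcm + P.Rcn then bits (List.ofFn (prev (s.ucn w) k)) (p - 2 * P.Rcm)
      else if p < 2 * P.Rcm + P.Rcn + P.Rcf then
        bits (List.ofFn (s.ucf w k)) (p - (2 * P.Rcm + P.Rcn))
      else if p < 2 * P.Rcm + P.Rcn + P.Rcf + P.l1 ch then 0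
      else if p < 2 * P.Rcm + P.Rcn + P.Rcf + P.l1 ch + P.Rp1 then
        bits (List.ofFn (s.up1 w k)) (p - (2 * P.Rcm + P.Rcn + P.Rcf + P.l1 ch))
      else if p < 2 * P.Rcm + 2 * P.Rcn + P.Rcf + P.l1 ch + P.Rp1 then
        bits (List.ofFn (s.ucn w k)) (p - (2 * P.Rcm + P.Rcn + P.Rcf + P.l1 ch + P.Rp1))
      else bits (List.ofFn (s.up2 w k))
        (p - (2 * P.Rcm + 2 * P.Rcn + P.Rcf + P.l1 ch + P.Rp1)) := by
  have e : 2 * P.Rcm + 2 * P.Rcn + P.Rcf + P.l1 ch + P.Rp1 =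
    2 * P.Rcm + P.Rcn + P.Rcf + P.l1 ch + P.Rp1 + P.Rcn := by ring
  rw [e]
  simp only [Signals.txVector, bits_append, List.length_append, List.length_ofFn,
    List.length_replicate, bits_replicate]
  split_ifs <;> first | rfl | omega

namespace Signals

variable {M N : ℕ} (s : P.Signals ch M N) (w : Fin M) (k : ℕ) {j : ℕ}

theorem txVector_prev (hj : j < P.Rcn) :
    bits (s.txVector w k) (2 * P.Rcm + j) = bits (List.ofFn (prev (s.ucn w) k)) j := by
  rw [bits_txVector, if_neg (by omega), if_pos (by omega), Nat.add_sub_cancel_left]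

theorem txVector_cf (hj : j < P.Rcf) :
    bits (s.txVector w k) (2 * P.Rcm + P.Rcn + j) = bits (List.ofFn (s.ucf w k)) j := by
  rw [bits_txVector, if_neg (by omega), if_neg (by omega), if_pos (by omega),
    Nat.add_sub_cancel_left]

theorem txVector_zero (hj : j < P.l1 ch) :
    bits (s.txVector w k) (2 * P.Rcm + P.Rcn + P.Rcf + j) = 0 := by
  rw [bits_txVector, if_neg (by omega), if_neg (by omega), if_neg (by omega), if_pos (by omega)]

theorem txVector_p1 (hj : j < P.Rp1) :
    bits (s.txVector w k) (2 * P.Rcm + P.Rcn + P.Rcf + P.l1 ch + j) =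
      bits (List.ofFn (s.up1 w k)) j := by
  rw [bits_txVector, if_neg (by omega), if_neg (by omega), if_neg (by omega), if_neg (by omega),
    if_pos (by omega), Nat.add_sub_cancel_left]

theorem txVector_cn (hj : j < P.Rcn) :
    bits (s.txVector w k) (2 * P.Rcm + P.Rcn + P.Rcf + P.l1 ch + P.Rp1 + j) =
      bits (List.ofFn (s.ucn w k)) j := by
  rw [bits_txVector, if_neg (by omega), if_neg (by omega), if_neg (by omega), if_neg (by omega),
    if_neg (by omega), if_pos (by omega), Nat.add_sub_cancel_left]

theorem txVector_p2 :
    bits (s.txVector w k) (2 * P.Rcm + 2 * P.Rcn + P.Rcf + P.l1 ch + P.Rp1 + j) =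
      bits (List.ofFn (s.up2 w k)) j := by
  rw [bits_txVector, if_neg (by omega), if_neg (by omega), if_neg (by omega), if_neg (by omega),
    if_neg (by omega), if_neg (by omega), Nat.add_sub_cancel_left]

end Signals

theorem bits_relayCN {M₁ M₂ N : ℕ} (s₁ : P.Signals ch M₁ N) (s₂ : P.Signals ch M₂ N)
    (w₁ : Fin M₁) (w₂ : Fin M₂) (k p : ℕ) :
    bits (relayCN s₁ s₂ w₁ w₂ k) p =
      if P.l5 ch ≤ p ∧ p < P.l5 ch + P.l6 ch then
        bits (List.ofFn (prev (s₁.ucn w₁) k)) (p - P.l5 ch) +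
          bits (List.ofFn (prev (s₂.ucn w₂) k)) (p - P.l5 ch)
      else 0 := by
  simp only [relayCN, bits_append, List.length_replicate, bits_replicate, bits_take, bits_ofFn_add]
  split_ifs <;> first | rfl | omega

/-- The CF vector of the relay if its two parts are contiguous. -/
theorem bits_relayCF {M₁ M₂ N : ℕ} (s₁ : P.Signals ch M₁ N) (s₂ : P.Signals ch M₂ N)
    (w₁ : Fin M₁) (w₂ : Fin M₂) (k p : ℕ) (h3 : P.l3 = 0) :
    bits (relayCF s₁ s₂ w₁ w₂ k) p =
      if P.l2 ch ≤ p ∧ p < P.l2 ch + P.Rcf then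
        bits (List.ofFn (prev (s₁.ucf w₁) k)) (p - P.l2 ch) +
          bits (List.ofFn (prev (s₂.ucf w₂) k)) (p - P.l2 ch)
      else 0 := by
  have e : relayCF s₁ s₂ w₁ w₂ k = List.replicate (P.l2 ch) 0 ++
      List.ofFn (prev (s₁.ucf w₁) k + prev (s₂.ucf w₂) k) := by
    simp only [relayCF, h3, List.replicate_zero, List.append_nil, List.append_assoc,
      List.take_append_drop]
  rw [e, bits_append, List.length_replicate, bits_replicate, bits_ofFn_add]
  split_ifs with h1 h2 h2
  · omega
  · rfl
  · rfl
  · rw [bits_of_length_le _ (by simp only [List.length_ofFn]; omega),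
      bits_of_length_le _ (by simp only [List.length_ofFn]; omega), add_zero]

/-- The relay sends only sums over both users. This symmetry lets receiver 2 be treated as receiver
1 with the users exchanged. -/
theorem relayCF_comm {M₁ M₂ N : ℕ} (s₁ : P.Signals ch M₁ N) (s₂ : P.Signals ch M₂ N)
    (w₁ : Fin M₁) (w₂ : Fin M₂) (k : ℕ) :
    relayCF s₁ s₂ w₁ w₂ k = relayCF s₂ s₁ w₂ w₁ k := by
  simp only [relayCF, add_comm (prev (s₁.ucf w₁) k)]

theorem relayCN_comm {M₁ M₂ N : ℕ} (s₁ : P.Signals ch M₁ N) (s₂ : P.Signals ch M₂ N)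
    (w₁ : Fin M₁) (w₂ : Fin M₂) (k : ℕ) :
    relayCN s₁ s₂ w₁ w₂ k = relayCN s₂ s₁ w₂ w₁ k := by
  simp only [relayCN, add_comm (prev (s₁.ucn w₁) k)]

/-- The output at the receiver of transmitter 1 in a block, on its levels from the top. -/
def blockOutput {M₁ M₂ N : ℕ} (s₁ : P.Signals ch M₁ N) (s₂ : P.Signals ch M₂ N)
    (w₁ : Fin M₁) (w₂ : Fin M₂) (k p : ℕ) : ZMod 2 :=
  shiftDown (P.T * (ch.q - ch.nd)) (bits (s₁.txVector w₁ k)) p +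
    shiftDown (P.T * (ch.q - ch.nc)) (bits (s₂.txVector w₂ k)) p +
    shiftDown (P.T * (ch.q - ch.nr))
      (fun j => bits (relayCF s₁ s₂ w₁ w₂ k) j + bits (relayCN s₁ s₂ w₁ w₂ k) j) p

end WI2Params

/-! ### Channel outputs in block form and error-free decoders -/

theorem block_time {T n k p : ℕ} (hT : 0 < T) (hk : k < n / T) : k * T + p % T < n := by
  have h1 : (k + 1) * T ≤ n / T * T := Nat.mul_le_mul_right _ hk
  have h2 := Nat.div_mul_le_self n T
  have h3 := Nat.mod_lt p hT
  rw [Nat.add_mul] at h1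
  omega

theorem block_div {T k p : ℕ} (hT : 0 < T) : (k * T + p % T) / T = k := by
  rw [Nat.mul_comm, Nat.mul_add_div hT, Nat.div_eq_of_lt (Nat.mod_lt p hT), add_zero]

theorem block_mod {T k p : ℕ} : (k * T + p % T) % T = p % T := by
  rw [Nat.mul_comm, Nat.mul_add_mod, Nat.mod_mod]

theorem block_pos {T p : ℕ} : p / T * T + p % T = p := Nat.div_add_mod' p T

namespace WI2Code

variable {ch : LDIRC} {P : WI2Params} {n M₁ M₂ : ℕ} (C : ch.WI2Code P n M₁ M₂)

/-- Position `p` of a block is level `p / T` in channel use `p % T`. A link moves levels only, so it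
acts on the block as a shift by a multiple of `T` and does not mix channel uses. -/
theorem output₁_block (hT : 0 < P.T) (w₁ : Fin M₁) (w₂ : Fin M₂) {k p : ℕ} (hk : k < n / P.T)
    (hp : p / P.T < ch.q) :
    C.output₁ w₁ w₂ ⟨k * P.T + p % P.T, block_time hT hk⟩ ⟨p / P.T, hp⟩ =
      WI2Params.blockOutput C.s₁ C.s₂ w₁ w₂ k p := by
  have hm := Nat.mod_lt p hT
  simp only [Code.output₁, Pi.add_apply, WI2Params.blockOutput]
  congr 1
  · congr 1
    · rw [link_eq_shiftDown ch _ hm _ (bits (C.s₁.txVector w₁ k)), block_pos]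
      intro i
      rw [C.enc₁_eq, WI2Params.bitAt_eq_bits, block_div hT, block_mod]
    · rw [link_eq_shiftDown ch _ hm _ (bits (C.s₂.txVector w₂ k)), block_pos]
      intro i
      rw [C.enc₂_eq, WI2Params.bitAt_eq_bits, block_div hT, block_mod]
  · rw [link_eq_shiftDown ch _ hm _ (fun j => bits (WI2Params.relayCF C.s₁ C.s₂ w₁ w₂ k) j +
      bits (WI2Params.relayCN C.s₁ C.s₂ w₁ w₂ k) j), block_pos]
    intro i
    rw [C.relay_eq, WI2Params.bitAt_eq_bits, WI2Params.bitAt_eq_bits, block_div hT, block_mod]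

theorem output₂_block (hT : 0 < P.T) (w₁ : Fin M₁) (w₂ : Fin M₂) {k p : ℕ} (hk : k < n / P.T)
    (hp : p / P.T < ch.q) :
    C.output₂ w₁ w₂ ⟨k * P.T + p % P.T, block_time hT hk⟩ ⟨p / P.T, hp⟩ =
      WI2Params.blockOutput C.s₂ C.s₁ w₂ w₁ k p := by
  have hm := Nat.mod_lt p hT
  simp only [Code.output₂, Pi.add_apply, WI2Params.blockOutput]
  congr 1
  · congr 1
    · rw [link_eq_shiftDown ch _ hm _ (bits (C.s₂.txVector w₂ k)), block_pos]
      intro i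
      rw [C.enc₂_eq, WI2Params.bitAt_eq_bits, block_div hT, block_mod]
    · rw [link_eq_shiftDown ch _ hm _ (bits (C.s₁.txVector w₁ k)), block_pos]
      intro i
      rw [C.enc₁_eq, WI2Params.bitAt_eq_bits, block_div hT, block_mod]
  · rw [WI2Params.relayCF_comm, WI2Params.relayCN_comm,
      link_eq_shiftDown ch _ hm _ (fun j => bits (WI2Params.relayCF C.s₁ C.s₂ w₁ w₂ k) j +
      bits (WI2Params.relayCN C.s₁ C.s₂ w₁ w₂ k) j), block_pos]
    intro i
    rw [C.relay_eq, WI2Params.bitAt_eq_bits, WI2Params.bitAt_eq_bits, block_div hT, block_mod]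

/-- If at each receiver the block outputs determine the desired message and the common message of
the other user, then there is a code with the same signals and without decoding errors. -/
theorem exists_noError (hT : 0 < P.T) (h₁ : 0 < M₁) (h₂ : 0 < M₂)
    (H₁ : ∀ w₁ w₂ w₁' w₂', (∀ k < n / P.T, ∀ p < ch.q * P.T,
      WI2Params.blockOutput C.s₁ C.s₂ w₁ w₂ k p = WI2Params.blockOutput C.s₁ C.s₂ w₁' w₂' k p) →
      w₁ = w₁' ∧ C.s₂.common w₂ = C.s₂.common w₂')
    (H₂ : ∀ w₁ w₂ w₁' w₂', (∀ k < n / P.T, ∀ p < ch.q * P.T,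
      WI2Params.blockOutput C.s₂ C.s₁ w₂ w₁ k p = WI2Params.blockOutput C.s₂ C.s₁ w₂' w₁' k p) →
      w₂ = w₂' ∧ C.s₁.common w₁ = C.s₁.common w₁') :
    ∃ C' : ch.WI2Code P n M₁ M₂, ∀ w, ¬ C'.SchemeError w := by
  classical
  have K₁ : ∀ w w' : Fin M₁ × Fin M₂, C.output₁ w.1 w.2 = C.output₁ w'.1 w'.2 →
      w.1 = w'.1 ∧ C.s₂.common w.2 = C.s₂.common w'.2 := by
    intro w w' h
    refine H₁ _ _ _ _ fun k hk p hp => ?_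
    have hp' : p / P.T < ch.q := Nat.div_lt_of_lt_mul (by rwa [Nat.mul_comm])
    rw [← output₁_block C hT _ _ hk hp', h, output₁_block C hT _ _ hk hp']
  have K₂ : ∀ w w' : Fin M₁ × Fin M₂, C.output₂ w.1 w.2 = C.output₂ w'.1 w'.2 →
      w.2 = w'.2 ∧ C.s₁.common w.1 = C.s₁.common w'.1 := by
    intro w w' h
    refine H₂ _ _ _ _ fun k hk p hp => ?_
    have hp' : p / P.T < ch.q := Nat.div_lt_of_lt_mul (by rwa [Nat.mul_comm])
    rw [← output₂_block C hT _ _ hk hp', h, output₂_block C hT _ _ hk hp']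
  have : Nonempty (Fin M₁ × Fin M₂) := ⟨(⟨0, h₁⟩, ⟨0, h₂⟩)⟩
  let D₁ : (Fin n → ch.Signal) → Fin M₁ × Fin M₂ :=
    Function.invFun fun w : Fin M₁ × Fin M₂ => C.output₁ w.1 w.2
  let D₂ : (Fin n → ch.Signal) → Fin M₁ × Fin M₂ :=
    Function.invFun fun w : Fin M₁ × Fin M₂ => C.output₂ w.1 w.2
  have E₁ : ∀ w : Fin M₁ × Fin M₂, C.output₁ (D₁ (C.output₁ w.1 w.2)).1
      (D₁ (C.output₁ w.1 w.2)).2 = C.output₁ w.1 w.2 := fun w =>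
    Function.invFun_eq (f := fun w : Fin M₁ × Fin M₂ => C.output₁ w.1 w.2) ⟨w, rfl⟩
  have E₂ : ∀ w : Fin M₁ × Fin M₂, C.output₂ (D₂ (C.output₂ w.1 w.2)).1
      (D₂ (C.output₂ w.1 w.2)).2 = C.output₂ w.1 w.2 := fun w =>
    Function.invFun_eq (f := fun w : Fin M₁ × Fin M₂ => C.output₂ w.1 w.2) ⟨w, rfl⟩
  refine ⟨{ C with
    dec₁ := fun y => (D₁ y).1
    dec₂ := fun y => (D₂ y).2
    commonDec₁ := fun y => C.s₂.common (D₁ y).2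
    commonDec₂ := fun y => C.s₁.common (D₂ y).1
    enc₁_eq := C.enc₁_eq
    enc₂_eq := C.enc₂_eq
    relay_eq := C.relay_eq }, fun w => ?_⟩
  have k₁ := K₁ _ _ (E₁ w)
  have k₂ := K₂ _ _ (E₂ w)
  rintro ((h | h) | h | h)
  · exact h k₁.1
  · exact h k₂.1
  · exact h k₁.2
  · exact h k₂.2

end WI2Code

end LDIRC

/-! ### Causal realization of the relay -/

namespace LDIRC

namespace WI2Params

variable (P : WI2Params) (ch : LDIRC)

/-- The relay vector of a block that carries given CF and CN signals. -/
def relayVector (cf : Fin P.Rcf → ZMod 2) (cn : Fin P.Rcn → ZMod 2) (p : ℕ) : ZMod 2 :=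
  bits (List.replicate (P.l2 ch) 0 ++ (List.ofFn cf).take P.l4 ++ List.replicate P.l3 0 ++
    (List.ofFn cf).drop P.l4) p +
  bits (List.replicate (P.l5 ch) 0 ++ (List.ofFn cn).take (P.l6 ch)) p

theorem relayVector_zero (p : ℕ) : P.relayVector ch 0 0 p = 0 := by
  simp only [relayVector, bits_append, bits_take, bits_drop, bits_replicate, bits_ofFn_zero,
    ite_self, add_zero]

variable {ch}

/-- The bit on position `p` of the block vector that the relay observes in block `b`, as far as it
is known in channel use `t`. -/
def observedBit {t : ℕ} (y : Fin t → ch.Signal) (b p : ℕ) : ZMod 2 :=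
  if h : b * P.T + p % P.T < t ∧ p / P.T + (ch.q - ch.ns) < ch.q then y ⟨_, h.1⟩ ⟨_, h.2⟩ else 0

/-- The vector of the bits from position `a` on that the relay observes in the block before channel
use `t`. -/
def observed {t : ℕ} (y : Fin t → ch.Signal) (a R : ℕ) : Fin R → ZMod 2 :=
  if t / P.T = 0 then 0 else fun j => P.observedBit y (t / P.T - 1) (a + j.val)

end WI2Params

variable {ch : LDIRC} {P : WI2Params} {n M₁ M₂ : ℕ}

open WI2Params

/-- The code given by the signals of the transmitters, with given decoders. -/
def codeOfSignals (s₁ : P.Signals ch M₁ (n / P.T)) (s₂ : P.Signals ch M₂ (n / P.T))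
    (h₁ : 0 < M₁) (h₂ : 0 < M₂) : ch.Code n M₁ M₂ where
  enc₁ w t i := bitAt P.T (s₁.txVector w (t.val / P.T)) t.val i.val
  enc₂ w t i := bitAt P.T (s₂.txVector w (t.val / P.T)) t.val i.val
  relay t y i := P.relayVector ch (P.observed y (2 * P.Rcm + P.Rcn) P.Rcf)
    (P.observed y (2 * P.Rcm + P.Rcn + P.Rcf + P.l1 ch + P.Rp1) P.Rcn) (i.val * P.T + t.val % P.T)
  relay_first t ht y := by
    funext i
    have : t.val / P.T = 0 := by rw [ht, Nat.zero_div]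
    simp only [WI2Params.observed, if_pos this, relayVector_zero, Pi.zero_apply]
  dec₁ _ := ⟨0, h₁⟩
  dec₂ _ := ⟨0, h₂⟩

theorem ns_le_q (ch : LDIRC) : ch.ns ≤ ch.q := le_max_of_le_right (le_max_right _ _)

theorem observedBit_codeOfSignals (s₁ : P.Signals ch M₁ (n / P.T)) (s₂ : P.Signals ch M₂ (n / P.T))
    (h₁ : 0 < M₁) (h₂ : 0 < M₂) (hT : 0 < P.T) (w₁ : Fin M₁) (w₂ : Fin M₂) (t : Fin n) {b p : ℕ}
    (hb : b < t.val / P.T) (hp : p < P.T * ch.ns) :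
    P.observedBit (fun j : Fin t.val => (codeOfSignals s₁ s₂ h₁ h₂).relayOutput w₁ w₂
      ⟨j.val, j.isLt.trans t.isLt⟩) b p = bits (s₁.txVector w₁ b) p + bits (s₂.txVector w₂ b) p := by
  have hq := ch.ns_le_q
  have hp' : p / P.T < ch.ns := Nat.div_lt_of_lt_mul hp
  have hc : b * P.T + p % P.T < t.val ∧ p / P.T + (ch.q - ch.ns) < ch.q :=
    ⟨block_time hT hb, by omega⟩
  rw [WI2Params.observedBit, dif_pos hc]
  simp only [Code.relayOutput, Pi.add_apply, link_apply, Nat.le_add_left, if_true,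
    Nat.add_sub_cancel, codeOfSignals, bitAt_eq_bits, block_div hT, block_mod, block_pos]

/-- The relay is defined from its past outputs alone. The bound `a + R ≤ T * ns` places the segment
on levels that it hears, and the preceding block is complete by channel use `t`. In block 0 both
sides are zero by convention. -/
theorem observed_codeOfSignals (s₁ : P.Signals ch M₁ (n / P.T)) (s₂ : P.Signals ch M₂ (n / P.T))
    (h₁ : 0 < M₁) (h₂ : 0 < M₂) (hT : 0 < P.T) (w₁ : Fin M₁) (w₂ : Fin M₂) (t : Fin n) {a R : ℕ}
    (ha : a + R ≤ P.T * ch.ns) (u₁ u₂ : ℕ → Fin R → ZMod 2)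
    (hu₁ : ∀ k, ∀ j : Fin R, bits (s₁.txVector w₁ k) (a + j.val) = u₁ k j)
    (hu₂ : ∀ k, ∀ j : Fin R, bits (s₂.txVector w₂ k) (a + j.val) = u₂ k j) :
    P.observed (fun j : Fin t.val => (codeOfSignals s₁ s₂ h₁ h₂).relayOutput w₁ w₂
      ⟨j.val, j.isLt.trans t.isLt⟩) a R =
      prev u₁ (t.val / P.T) + prev u₂ (t.val / P.T) := by
  by_cases h : t.val / P.T = 0
  · simp only [WI2Params.observed, prev, if_pos h, add_zero]
  · funext j
    simp only [WI2Params.observed, prev, if_neg h, Pi.add_apply]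
    rw [observedBit_codeOfSignals s₁ s₂ h₁ h₂ hT w₁ w₂ t (Nat.sub_one_lt h)
      (by have := j.isLt; omega), hu₁, hu₂]

/-- The code of scheme WI-2 given by the signals of the transmitters. -/
def wi2CodeOfSignals (hP : P.Feasible ch) (s₁ : P.Signals ch M₁ (n / P.T))
    (s₂ : P.Signals ch M₂ (n / P.T)) (h₁ : 0 < M₁) (h₂ : 0 < M₂) : ch.WI2Code P n M₁ M₂ where
  toCode := codeOfSignals s₁ s₂ h₁ h₂
  s₁ := s₁
  s₂ := s₂
  enc₁_eq _ _ _ := rfl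
  enc₂_eq _ _ _ := rfl
  relay_eq w₁ w₂ t i := by
    have hobs := hP.relay_observes
    have hcf := observed_codeOfSignals s₁ s₂ h₁ h₂ hP.T_pos w₁ w₂ t
      (a := 2 * P.Rcm + P.Rcn) (R := P.Rcf) (by omega) (s₁.ucf w₁) (s₂.ucf w₂)
      (fun k j => by rw [s₁.txVector_cf w₁ k j.isLt, bits_ofFn_of_lt])
      (fun k j => by rw [s₂.txVector_cf w₂ k j.isLt, bits_ofFn_of_lt])
    have hcn := observed_codeOfSignals s₁ s₂ h₁ h₂ hP.T_pos w₁ w₂ t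
      (a := 2 * P.Rcm + P.Rcn + P.Rcf + P.l1 ch + P.Rp1) (R := P.Rcn) (by omega)
      (s₁.ucn w₁) (s₂.ucn w₂)
      (fun k j => by rw [s₁.txVector_cn w₁ k j.isLt, bits_ofFn_of_lt])
      (fun k j => by rw [s₂.txVector_cn w₂ k j.isLt, bits_ofFn_of_lt])
    change P.relayVector ch (P.observed _ _ _) (P.observed _ _ _) _ = _
    rw [hcf, hcn]
    rfl
  commonDec₁ _ := s₂.common ⟨0, h₂⟩
  commonDec₂ _ := s₁.common ⟨0, h₁⟩

/-- The signals that vanish everywhere. -/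
def WI2Params.Signals.zero (P : WI2Params) (ch : LDIRC) (M N : ℕ) : P.Signals ch M N where
  Mcm := 1
  Mcm_le := Nat.one_le_two_pow
  common _ := 0
  ucm _ _ := 0
  ucn _ _ := 0
  ucf _ _ := 0
  up1 _ _ := 0
  up2 _ _ := 0
  ucm_last _ _ _ := rfl
  ucn_last _ _ _ := rfl
  ucf_last _ _ _ := rfl
  up1_last _ _ _ := rfl
  up2_last _ _ _ := rfl

/-! ### From error-free blocks to achievable rates -/

theorem schemeErrorProb_of_noError (C : ch.WI2Code P n M₁ M₂) (h : ∀ w, ¬ C.SchemeError w) :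
    C.schemeErrorProb = 0 := by
  have : {w : Fin M₁ × Fin M₂ | C.SchemeError w} = ∅ :=
    Set.eq_empty_iff_forall_notMem.2 h
  rw [WI2Code.schemeErrorProb, this, Set.ncard_empty, Nat.cast_zero, zero_div]

theorem errorProb_le_schemeErrorProb (C : ch.WI2Code P n M₁ M₂) :
    C.errorProb ≤ C.schemeErrorProb := by
  refine div_le_div_of_nonneg_right (Nat.cast_le.2 ?_) (by positivity)
  exact Set.ncard_le_ncard (fun w hw => Or.inl hw) (Set.toFinite _)

theorem numMessages_pos (n : ℕ) {r : ℝ} (hr : 0 ≤ r) : 0 < numMessages n r :=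
  Nat.floor_pos.2 (Real.one_le_rpow one_le_two (by positivity))

theorem numMessages_le {n m : ℕ} {r : ℝ} (h : (n : ℝ) * r ≤ m) : numMessages n r ≤ 2 ^ m := by
  refine Nat.floor_le_of_le ?_
  calc (2 : ℝ) ^ ((n : ℝ) * r) ≤ (2 : ℝ) ^ (m : ℝ) :=
        Real.rpow_le_rpow_of_exponent_le one_le_two h
    _ = ((2 ^ m : ℕ) : ℝ) := by rw [Real.rpow_natCast]; push_cast; rfl

/-- If `B` bits per block and user can be sent without errors in all blocks but the last one, then
the scheme achieves the corresponding sum-rate. -/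
theorem wi2Achieves_of_noError (hP : P.Feasible ch) (B : ℕ)
    (H : ∀ n M, 0 < M → M ≤ 2 ^ ((n / P.T - 1) * B) →
      ∃ C : ch.WI2Code P n M M, ∀ w, ¬ C.SchemeError w) :
    ch.WI2Achieves P (2 * (B : ℝ) / P.T) := by
  classical
  intro ε hε
  have hT : (0 : ℝ) < P.T := Nat.cast_pos.2 hP.T_pos
  -- A loss of `ε / 4` per user keeps the sum-rate within `ε / 2`; for long codes it pays for the
  -- idle last block and the incomplete block.
  set r : ℝ := max 0 ((B : ℝ) / P.T - ε / 4) with hr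
  have hr0 : 0 ≤ r := le_max_left _ _
  refine ⟨r, hr0, ?_, ?_⟩
  · have : (B : ℝ) / P.T - ε / 4 ≤ r := le_max_right _ _
    have e : 2 * (B : ℝ) / P.T = (B : ℝ) / P.T + (B : ℝ) / P.T := by ring
    linarith
  · have hcode : ∀ n, ∃ C : ch.WI2Code P n (numMessages n r) (numMessages n r),
        (n : ℝ) * r ≤ ((n / P.T - 1) * B : ℕ) → ∀ w, ¬ C.SchemeError w := by
      intro n
      by_cases h : (n : ℝ) * r ≤ ((n / P.T - 1) * B : ℕ)
      · obtain ⟨C, hC⟩ := H n _ (numMessages_pos n hr0) (numMessages_le h)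
        exact ⟨C, fun _ => hC⟩
      -- Lengths too short for all the messages get a silent code. This does not affect the limit.
      · exact ⟨wi2CodeOfSignals hP (Signals.zero P ch _ _) (Signals.zero P ch _ _)
          (numMessages_pos n hr0) (numMessages_pos n hr0), fun h' => absurd h' h⟩
    choose C hC using hcode
    refine ⟨C, tendsto_const_nhds.congr' ?_⟩
    filter_upwards [eventually_ge_atTop ⌈8 * (B : ℝ) / ε⌉₊] with n hn
    refine (schemeErrorProb_of_noError _ (hC n ?_)).symm
    rcases le_total ((B : ℝ) / P.T - ε / 4) 0 with h | h
    · rw [hr, max_eq_left h, mul_zero]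
      positivity
    · rw [hr, max_eq_right h]
      have hn' : 8 * (B : ℝ) ≤ n * ε := (div_le_iff₀ hε).1 (Nat.ceil_le.1 hn)
      -- One block is lost to rounding and one to the zero signals at the end; `n ≥ 8 B / ε` gives
      -- `2 B ≤ n ε / 4`.
      have h1 : (n : ℝ) / P.T - 2 ≤ ((n / P.T - 1 : ℕ) : ℝ) := by
        have h2 : (n : ℝ) / P.T < ((n / P.T : ℕ) : ℝ) + 1 := by
          rw [div_lt_iff₀ hT]
          have := Nat.lt_div_mul_add (a := n) hP.T_pos
          have h3 : n < (n / P.T + 1) * P.T := by rw [Nat.add_mul, one_mul]; exact this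
          exact_mod_cast h3
        have h3 : ((n / P.T : ℕ) : ℝ) ≤ ((n / P.T - 1 : ℕ) : ℝ) + 1 := by
          exact_mod_cast (by omega : n / P.T ≤ n / P.T - 1 + 1)
        linarith
      have h2 := mul_le_mul_of_nonneg_right h1 (Nat.cast_nonneg (α := ℝ) B)
      push_cast
      calc (n : ℝ) * ((B : ℝ) / P.T - ε / 4) = (n : ℝ) / P.T * B - n * ε / 4 := by ring
        _ ≤ ((n : ℝ) / P.T - 2) * B := by linarith
        _ ≤ _ := h2

theorem WI2Achieves.achievable {R : ℝ} (h : ch.WI2Achieves P R) {ε : ℝ} (hε : 0 < ε) :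
    ∃ R₁ R₂ : ℝ, ch.Achievable R₁ R₂ ∧ R - ε < R₁ + R₂ := by
  obtain ⟨r, hr, hlt, C, hC⟩ := h ε hε
  refine ⟨r, r, ⟨hr, hr, fun n => (C n).toCode, ?_⟩, hlt⟩
  refine squeeze_zero (fun n => ?_) (fun n => errorProb_le_schemeErrorProb (C n)) hC
  unfold Code.errorProb
  positivity

end LDIRC

/-! ### Successive decoding within a block and backward decoding over the blocks -/

namespace LDIRC

open WI2Params

/-- There are `B` bits per block, for all blocks but the last one, that determine the message. -/
theorem exists_messageBits {M N B : ℕ} (h : M ≤ 2 ^ ((N - 1) * B)) :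
    ∃ b : Fin M → ℕ → ℕ → ZMod 2, (∀ w k, N ≤ k + 1 → b w k = 0) ∧
      (∀ w k j, B ≤ j → b w k j = 0) ∧
      ∀ w w', (∀ k < N, ∀ j < B, b w k j = b w' k j) → w = w' := by
  have hc : Fintype.card (Fin M) ≤ Fintype.card (Fin (N - 1) × Fin B → ZMod 2) := by
    simpa [ZMod.card] using h
  obtain ⟨e⟩ := Function.Embedding.nonempty_of_card_le hc
  refine ⟨fun w k j => if h : k < N - 1 ∧ j < B then e w (⟨k, h.1⟩, ⟨j, h.2⟩) else 0, ?_, ?_, ?_⟩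
  · intro w k hk
    funext j
    exact dif_neg (by omega)
  · intro w k j hj
    exact dif_neg (by omega)
  · intro w w' h
    refine e.injective (funext fun x => ?_)
    have hx := h x.1.val (by have := x.1.isLt; omega) x.2.val x.2.isLt
    simpa using hx

/-- Successive decoding from the top-most level down: the interference `A` arrives `δ` levels below
the desired signal `X` and is known once `X` is known, and `G` arrives on levels on which `X` is
known. -/
theorem successive_decoding {X A G X' A' G' : ℕ → ZMod 2} {δ D : ℕ} (hδ : 0 < δ)
    (hY : ∀ p < D, X p + shiftDown δ A p + G p = X' p + shiftDown δ A' p + G' p)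
    (hA : ∀ j, j + δ < D → X j = X' j → A j = A' j)
    (hXG : ∀ p < D, (G p = 0 ∧ G' p = 0) ∨ X p = X' p) :
    ∀ p < D, X p = X' p ∧ G p = G' p := by
  intro p
  induction p using Nat.strong_induction_on with
  | _ p ih =>
    intro hp
    -- As `δ > 0`, the interference on level `p` depends on the desired signal on level `p - δ < p`
    -- only.
    have hs : shiftDown δ A p = shiftDown δ A' p := by
      unfold shiftDown
      split_ifs with h
      · exact hA _ (by omega) (ih _ (by omega) (by omega)).1
      · rfl
    have hy := hY p hp
    rw [hs] at hy
    rcases hXG p hp with ⟨h1, h2⟩ | h1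
    · refine ⟨?_, by rw [h1, h2]⟩
      rw [h1, h2] at hy
      simpa using hy
    · rw [h1] at hy
      exact ⟨h1, add_left_cancel hy⟩

/-- Parameters without common signals for which the scheme has no decoding errors: the CF signal of
the relay is received on the zero levels and the levels of the new CN signal. -/
structure WI2Params.Decodable (P : WI2Params) (ch : LDIRC) : Prop where
  cross_lt : ch.nc < ch.nd
  nc_le : ch.nc ≤ ch.nr
  nr_le : ch.nr ≤ ch.nd
  ns_le : ch.ns ≤ ch.nd
  T_pos : 0 < P.T
  Rcm_eq : P.Rcm = 0
  l3_eq : P.l3 = 0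
  cross_eq : P.Rcn + P.Rcf + P.l1 ch = P.T * ch.nc
  total_eq : 2 * P.Rcn + P.Rcf + P.l1 ch + P.Rp1 + P.Rp2 = P.T * ch.nd
  cf_below : 0 < P.Rcf → P.Rcn + P.Rcf ≤ P.T * (ch.nd - ch.nr) + P.l2 ch
  cf_above : 0 < P.Rcf → P.T * (ch.nd - ch.nr) + P.l2 ch + P.Rcf + P.Rp2 ≤ P.T * ch.nd
  p1_free : 0 < P.Rcf → P.Rp1 = 0 ∨
    P.Rcn + P.Rcf + P.l1 ch + P.Rp1 ≤ P.T * (ch.nd - ch.nr) + P.l2 ch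

theorem q_eq_nd {ch : LDIRC} (hc : ch.nc ≤ ch.nd) (hr : ch.nr ≤ ch.nd) (hs : ch.ns ≤ ch.nd) :
    ch.q = ch.nd := by
  simp only [q]
  omega

theorem bits_prev {R : ℕ} (u : ℕ → Fin R → ZMod 2) (k p : ℕ) :
    bits (List.ofFn (prev u (k + 1))) p = bits (List.ofFn (u k)) p := by
  simp only [prev, Nat.add_one_ne_zero, if_false, Nat.add_sub_cancel]

namespace WI2Params

variable {ch : LDIRC} {P : WI2Params} {M₁ M₂ N : ℕ}

/-- The received interference, aligned with the cross link: the relay replaces the CN signal of the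
undesired user by the CN signal of the desired user. -/
def neutralized (s₁ : P.Signals ch M₁ N) (s₂ : P.Signals ch M₂ N) (w₁ : Fin M₁) (w₂ : Fin M₂)
    (k j : ℕ) : ZMod 2 :=
  if j < P.Rcn then bits (List.ofFn (prev (s₁.ucn w₁) k)) j
  else if j < P.Rcn + P.Rcf then bits (List.ofFn (s₂.ucf w₂ k)) (j - P.Rcn) else 0

/-- The CF signal of the relay on the levels of a receiver. -/
def receivedCF (s₁ : P.Signals ch M₁ N) (s₂ : P.Signals ch M₂ N) (w₁ : Fin M₁) (w₂ : Fin M₂)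
    (k p : ℕ) : ZMod 2 :=
  let σ := P.T * (ch.nd - ch.nr) + P.l2 ch
  if σ ≤ p ∧ p < σ + P.Rcf then
    bits (List.ofFn (prev (s₁.ucf w₁) k)) (p - σ) + bits (List.ofFn (prev (s₂.ucf w₂) k)) (p - σ)
  else 0

/-- The offset `l5` aligns the relay's CN sum with the old CN signal arriving over the cross link.
In characteristic two the undesired summand cancels, and the desired one remains. -/
theorem Decodable.blockOutput_eq (h : P.Decodable ch) (s₁ : P.Signals ch M₁ N)
    (s₂ : P.Signals ch M₂ N) (w₁ : Fin M₁) (w₂ : Fin M₂) {k p : ℕ} (hp : p < P.T * ch.nd) :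
    blockOutput s₁ s₂ w₁ w₂ k p = bits (s₁.txVector w₁ k) p +
      shiftDown (P.T * (ch.nd - ch.nc)) (neutralized s₁ s₂ w₁ w₂ k) p +
      receivedCF s₁ s₂ w₁ w₂ k p := by
  have hq := q_eq_nd h.cross_lt.le h.nr_le h.ns_le
  have h0 := h.Rcm_eq
  have hcr := h.cross_eq
  have e1 : P.T * (ch.nd - ch.nc) = P.T * ch.nd - P.T * ch.nc := Nat.mul_sub _ _ _
  have e2 : P.T * (ch.nd - ch.nr) = P.T * ch.nd - P.T * ch.nr := Nat.mul_sub _ _ _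
  have m1 : P.T * ch.nc ≤ P.T * ch.nr := Nat.mul_le_mul_left _ h.nc_le
  have m2 : P.T * ch.nr ≤ P.T * ch.nd := Nat.mul_le_mul_left _ h.nr_le
  have l5 : P.l5 ch = P.T * ch.nr - P.T * ch.nc := by simp only [WI2Params.l5, h0]; omega
  have l6 : P.l6 ch = P.Rcn := by simp only [WI2Params.l6, h0]; omega
  have hrel : shiftDown (P.T * (ch.nd - ch.nr))
      (fun j => bits (relayCF s₁ s₂ w₁ w₂ k) j + bits (relayCN s₁ s₂ w₁ w₂ k) j) p =
      receivedCF s₁ s₂ w₁ w₂ k p + shiftDown (P.T * (ch.nd - ch.nc))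
        (fun j => if j < P.Rcn then bits (List.ofFn (prev (s₁.ucn w₁) k)) j +
          bits (List.ofFn (prev (s₂.ucn w₂) k)) j else 0) p := by
    by_cases hr : P.T * (ch.nd - ch.nr) ≤ p
    · simp only [shiftDown, if_pos hr, bits_relayCF s₁ s₂ w₁ w₂ _ _ h.l3_eq, bits_relayCN,
        receivedCF]
      congr 1
      · rw [Nat.sub_sub]
        exact if_congr (by omega) rfl rfl
      · by_cases hc : P.T * (ch.nd - ch.nc) ≤ p
        · have e3 : p - P.T * (ch.nd - ch.nr) - P.l5 ch = p - P.T * (ch.nd - ch.nc) := by omega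
          rw [if_pos hc, e3]
          exact if_congr (by omega) rfl rfl
        · rw [if_neg hc, if_neg (by omega)]
    · simp only [shiftDown, receivedCF]
      rw [if_neg hr, if_neg (by omega), if_neg (by omega), add_zero]
  simp only [blockOutput, hq, Nat.sub_self, Nat.mul_zero]
  rw [hrel]
  have hX : shiftDown 0 (bits (s₁.txVector w₁ k)) p = bits (s₁.txVector w₁ k) p := by
    simp [shiftDown]
  rw [hX]
  have hI : shiftDown (P.T * (ch.nd - ch.nc)) (bits (s₂.txVector w₂ k)) p +
      shiftDown (P.T * (ch.nd - ch.nc))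
        (fun j => if j < P.Rcn then bits (List.ofFn (prev (s₁.ucn w₁) k)) j +
          bits (List.ofFn (prev (s₂.ucn w₂) k)) j else 0) p =
      shiftDown (P.T * (ch.nd - ch.nc)) (neutralized s₁ s₂ w₁ w₂ k) p := by
    unfold shiftDown
    by_cases hc : P.T * (ch.nd - ch.nc) ≤ p
    · simp only [if_pos hc]
      obtain ⟨j, hj⟩ : ∃ j, j = p - P.T * (ch.nd - ch.nc) := ⟨_, rfl⟩
      rw [← hj, Signals.bits_txVector, neutralized, if_neg (by omega)]
      by_cases h1 : j < P.Rcn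
      · rw [if_pos (by omega), if_pos h1, if_pos h1, h0, Nat.mul_zero, Nat.sub_zero]
        rw [add_left_comm, CharTwo.add_self_eq_zero, add_zero]
      · rw [if_neg (by omega), if_neg h1, if_neg h1, add_zero]
        by_cases h2 : j < P.Rcn + P.Rcf
        · rw [if_pos (by omega), if_pos h2, h0, Nat.mul_zero, Nat.zero_add]
        -- Below the CF signal the cross link delivers only the zero levels, since `Rcn + Rcf + l1 =
        -- T * nc`.
        · rw [if_neg (by omega), if_neg h2, if_pos (by omega)]
    · simp only [if_neg hc, add_zero]
  rw [← hI]
  ring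

/-- Decoding of one block, if the CN signal of the desired user and the sum of the CF signals of
the block are known. -/
theorem Decodable.block_decoding (h : P.Decodable ch) (s₁ : P.Signals ch M₁ N)
    (s₂ : P.Signals ch M₂ N) {w₁ w₁' : Fin M₁} {w₂ w₂' : Fin M₂} {k : ℕ}
    (hY : ∀ p < P.T * ch.nd, blockOutput s₁ s₂ w₁ w₂ k p = blockOutput s₁ s₂ w₁' w₂' k p)
    (hcn : s₁.ucn w₁ k = s₁.ucn w₁' k)
    (hcf : s₁.ucf w₁ k + s₂.ucf w₂ k = s₁.ucf w₁' k + s₂.ucf w₂' k) :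
    ∀ p < P.T * ch.nd, bits (s₁.txVector w₁ k) p = bits (s₁.txVector w₁' k) p ∧
      receivedCF s₁ s₂ w₁ w₂ k p = receivedCF s₁ s₂ w₁' w₂' k p := by
  have h0 := h.Rcm_eq
  have hcr := h.cross_eq
  have htot := h.total_eq
  refine successive_decoding (δ := P.T * (ch.nd - ch.nc)) ?_
    (A := neutralized s₁ s₂ w₁ w₂ k) (A' := neutralized s₁ s₂ w₁' w₂' k) ?_ ?_ ?_
  · exact Nat.mul_pos h.T_pos (Nat.sub_pos_of_lt h.cross_lt)
  · intro p hp
    rw [← h.blockOutput_eq s₁ s₂ _ _ hp, ← h.blockOutput_eq s₁ s₂ _ _ hp, hY p hp]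
  · intro j _ hj
    unfold neutralized
    split_ifs with h1 h2
    · have e : j = 2 * P.Rcm + j := by omega
      rw [e, s₁.txVector_prev w₁ k h1, s₁.txVector_prev w₁' k h1] at hj
      exact hj
    · obtain ⟨i, rfl⟩ := Nat.exists_eq_add_of_le (not_lt.1 h1)
      have hi : i < P.Rcf := by omega
      have e : P.Rcn + i = 2 * P.Rcm + P.Rcn + i := by omega
      rw [e, s₁.txVector_cf w₁ k hi, s₁.txVector_cf w₁' k hi] at hj
      rw [Nat.add_sub_cancel_left]
      have := congrArg (fun u => bits (List.ofFn u) i) hcf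
      simp only [bits_ofFn_add, hj] at this
      exact add_left_cancel this
    · rfl
  · intro p hp
    by_cases hσ : P.T * (ch.nd - ch.nr) + P.l2 ch ≤ p ∧
        p < P.T * (ch.nd - ch.nr) + P.l2 ch + P.Rcf
    · right
      have hf : 0 < P.Rcf := by omega
      have b1 := h.cf_below hf
      have b2 := h.cf_above hf
      have b3 := h.p1_free hf
      -- `cf_below`, `cf_above` and `p1_free` confine the relay's CF sum to the zero levels and the
      -- levels of the new CN signal, which is known by `hcn`.
      by_cases h1 : p < 2 * P.Rcm + P.Rcn + P.Rcf + P.l1 ch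
      · obtain ⟨i, rfl⟩ : ∃ i, p = 2 * P.Rcm + P.Rcn + P.Rcf + i :=
          Nat.exists_eq_add_of_le (by omega)
        rw [s₁.txVector_zero w₁ k (by omega), s₁.txVector_zero w₁' k (by omega)]
      · obtain ⟨i, rfl⟩ : ∃ i, p = 2 * P.Rcm + P.Rcn + P.Rcf + P.l1 ch + P.Rp1 + i :=
          Nat.exists_eq_add_of_le (by omega)
        rw [s₁.txVector_cn w₁ k (by omega), s₁.txVector_cn w₁' k (by omega), hcn]
    · left
      constructor <;> exact if_neg hσ

/-- Backward decoding: from the last block on, the CN signal of the desired user and the sum of the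
CF signals are known. -/
theorem Decodable.backward_decoding (h : P.Decodable ch) (s₁ : P.Signals ch M₁ N)
    (s₂ : P.Signals ch M₂ N) {w₁ w₁' : Fin M₁} {w₂ w₂' : Fin M₂}
    (hY : ∀ k < N, ∀ p < P.T * ch.nd,
      blockOutput s₁ s₂ w₁ w₂ k p = blockOutput s₁ s₂ w₁' w₂' k p) (k : ℕ) :
    s₁.ucn w₁ k = s₁.ucn w₁' k ∧
      s₁.ucf w₁ k + s₂.ucf w₂ k = s₁.ucf w₁' k + s₂.ucf w₂' k := by
  have h0 := h.Rcm_eq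
  have htot := h.total_eq
  suffices H : ∀ d k, N ≤ k + 1 + d → s₁.ucn w₁ k = s₁.ucn w₁' k ∧
      s₁.ucf w₁ k + s₂.ucf w₂ k = s₁.ucf w₁' k + s₂.ucf w₂' k from
    H N k (by omega)
  intro d
  induction d with
  | zero =>
    intro k hk
    have hk' : N ≤ k + 1 := hk
    simp only [s₁.ucn_last _ k hk', s₁.ucf_last _ k hk', s₂.ucf_last _ k hk', and_self]
  | succ d ih =>
    intro k hk
    by_cases hk' : N ≤ k + 1
    · simp only [s₁.ucn_last _ k hk', s₁.ucf_last _ k hk', s₂.ucf_last _ k hk', and_self]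
    · have hd := ih (k + 1) (by omega)
      -- Block `k + 1` is decoded from its own CN signal and CF sum. It contains those of block `k`:
      -- the former in the transmit vector, the latter in the relay signal.
      have hdec := h.block_decoding s₁ s₂ (hY (k + 1) (by omega)) hd.1 hd.2
      constructor
      · refine bits_ofFn_injective fun p hp => ?_
        have hx := (hdec (2 * P.Rcm + p) (by omega)).1
        rwa [s₁.txVector_prev w₁ _ hp, s₁.txVector_prev w₁' _ hp, bits_prev, bits_prev] at hx
      · refine bits_ofFn_injective fun p hp => ?_
        have b2 := h.cf_above (by omega)
        have hx := (hdec (P.T * (ch.nd - ch.nr) + P.l2 ch + p) (by omega)).2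
        simp only [receivedCF] at hx
        rw [if_pos (by omega), if_pos (by omega), Nat.add_sub_cancel_left] at hx
        simpa only [bits_prev, bits_ofFn_add] using hx

/-- The receiver recovers all signals of the desired transmitter. -/
theorem Decodable.signals_eq (h : P.Decodable ch) (s₁ : P.Signals ch M₁ N)
    (s₂ : P.Signals ch M₂ N) {w₁ w₁' : Fin M₁} {w₂ w₂' : Fin M₂}
    (hY : ∀ k < N, ∀ p < P.T * ch.nd,
      blockOutput s₁ s₂ w₁ w₂ k p = blockOutput s₁ s₂ w₁' w₂' k p) {k : ℕ} (hk : k < N) :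
    s₁.ucn w₁ k = s₁.ucn w₁' k ∧ s₁.ucf w₁ k = s₁.ucf w₁' k ∧ s₁.up1 w₁ k = s₁.up1 w₁' k ∧
      s₁.up2 w₁ k = s₁.up2 w₁' k := by
  have h0 := h.Rcm_eq
  have htot := h.total_eq
  obtain ⟨hcn, hcf⟩ := h.backward_decoding s₁ s₂ hY k
  have hdec := h.block_decoding s₁ s₂ (hY k hk) hcn hcf
  refine ⟨hcn, ?_, ?_, ?_⟩
  · refine bits_ofFn_injective fun p hp => ?_
    have hx := (hdec (2 * P.Rcm + P.Rcn + p) (by omega)).1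
    rwa [s₁.txVector_cf w₁ k hp, s₁.txVector_cf w₁' k hp] at hx
  · refine bits_ofFn_injective fun p hp => ?_
    have hx := (hdec (2 * P.Rcm + P.Rcn + P.Rcf + P.l1 ch + p) (by omega)).1
    rwa [s₁.txVector_p1 w₁ k hp, s₁.txVector_p1 w₁' k hp] at hx
  · refine bits_ofFn_injective fun p hp => ?_
    have hx := (hdec (2 * P.Rcm + 2 * P.Rcn + P.Rcf + P.l1 ch + P.Rp1 + p) (by omega)).1
    rwa [s₁.txVector_p2, s₁.txVector_p2] at hx

/-- The signals that carry given message bits as CN, CF and private signals. -/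
def Signals.ofBits (P : WI2Params) (ch : LDIRC) {M N : ℕ} (b : Fin M → ℕ → ℕ → ZMod 2)
    (hb : ∀ w k, N ≤ k + 1 → b w k = 0) : P.Signals ch M N where
  Mcm := 1
  Mcm_le := Nat.one_le_two_pow
  common _ := 0
  ucm _ _ := 0
  ucn w k j := b w k j.val
  ucf w k j := b w k (P.Rcn + j.val)
  up1 w k j := b w k (P.Rcn + P.Rcf + j.val)
  up2 w k j := b w k (P.Rcn + P.Rcf + P.Rp1 + j.val)
  ucm_last _ _ _ := rfl
  ucn_last w k hk := by funext j; rw [hb w k hk]; rfl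
  ucf_last w k hk := by funext j; rw [hb w k hk]; rfl
  up1_last w k hk := by funext j; rw [hb w k hk]; rfl
  up2_last w k hk := by funext j; rw [hb w k hk]; rfl

theorem Decodable.achieves (h : P.Decodable ch) (hP : P.Feasible ch) :
    ch.WI2Achieves P (2 * ((P.Rcn + P.Rcf + P.Rp1 + P.Rp2 : ℕ) : ℝ) / P.T) := by
  refine wi2Achieves_of_noError hP _ fun n M hM hMB => ?_
  obtain ⟨b, hlast, -, hinj⟩ := exists_messageBits hMB
  let s : P.Signals ch M (n / P.T) := Signals.ofBits P ch b hlast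
  have hq := q_eq_nd h.cross_lt.le h.nr_le h.ns_le
  have key : ∀ w₁ w₂ w₁' w₂', (∀ k < n / P.T, ∀ p < ch.q * P.T,
      blockOutput s s w₁ w₂ k p = blockOutput s s w₁' w₂' k p) →
      w₁ = w₁' ∧ s.common w₂ = s.common w₂' := by
    intro w₁ w₂ w₁' w₂' hY
    refine ⟨hinj _ _ fun k hk j hj => ?_, rfl⟩
    obtain ⟨h1, h2, h3, h4⟩ := h.signals_eq s s (w₁ := w₁) (w₂ := w₂) (w₁' := w₁') (w₂' := w₂')
      (fun k hk p hp => hY k hk p (by rwa [hq, Nat.mul_comm])) hk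
    by_cases c1 : j < P.Rcn
    · exact congrFun h1 ⟨j, c1⟩
    by_cases c2 : j < P.Rcn + P.Rcf
    · have := congrFun h2 ⟨j - P.Rcn, by omega⟩
      simpa only [s, Signals.ofBits, Nat.add_sub_of_le (not_lt.1 c1)] using this
    by_cases c3 : j < P.Rcn + P.Rcf + P.Rp1
    · have := congrFun h3 ⟨j - (P.Rcn + P.Rcf), by omega⟩
      simpa only [s, Signals.ofBits, Nat.add_sub_of_le (not_lt.1 c2)] using this
    · have := congrFun h4 ⟨j - (P.Rcn + P.Rcf + P.Rp1), by omega⟩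
      simpa only [s, Signals.ofBits, Nat.add_sub_of_le (not_lt.1 c3)] using this
  exact (wi2CodeOfSignals hP s s hM hM).exists_noError hP.T_pos hM hM key
    fun w₁ w₂ w₁' w₂' hY => key w₂ w₁ w₂' w₁' hY

end WI2Params

end LDIRC

/-! ### Explicit parameters for `nc < nd` -/

namespace LDIRC

open WI2Params

namespace WI2Params

/-- The parameters of scheme WI-2, on blocks of two channel uses, for a channel whose direct link is
stronger than the cross link. The CF signals carry `min {nc, 2 (nr + ns - nd)⁺}` bits. -/
def crossWeak (ch : LDIRC) : WI2Params where
  T := 2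
  Rcm := 0
  Rcn := min (min ch.nc (2 * (ch.nr + ch.ns - ch.nd))) (2 * (ch.ns - ch.nc))
  Rcf := min ch.nc (2 * (ch.nr + ch.ns - ch.nd))
  Rp1 := 2 * (ch.ns - ch.nc) -
    min (min ch.nc (2 * (ch.nr + ch.ns - ch.nd))) (2 * (ch.ns - ch.nc))
  Rp2 := 2 * (ch.nd - ch.ns)

/-- The parameters of scheme WI-2, with common signals only, for a channel with links of equal
strength. -/
def commonOnly (ch : LDIRC) : WI2Params := ⟨2, ch.nd, 0, 0, 0, 0⟩

variable {ch : LDIRC}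

/-- Names for the lengths turn feasibility and decodability into linear arithmetic, with one case
per branch of `l2`. The relay splits its CF signal only if `c < e`; then `c = 2 (ns - nc)`, so `Rp1
= 0` and the gap `l3` vanishes. -/
theorem crossWeak_lengths (h₁ : ch.nc ≤ ch.ns) (h₂ : ch.ns ≤ ch.nd) : ∃ e c : ℕ, (crossWeak ch).Rcf = e ∧ (crossWeak ch).Rcn = c ∧
      e = min ch.nc (2 * (ch.nr + ch.ns - ch.nd)) ∧ c = min e (2 * (ch.ns - ch.nc)) ∧
      (crossWeak ch).Rp1 = 2 * (ch.ns - ch.nc) - c ∧ (crossWeak ch).Rp2 = 2 * (ch.nd - ch.ns) ∧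
      (crossWeak ch).l1 ch = 2 * ch.nc - c - e ∧ (crossWeak ch).l3 = 0 ∧
      (crossWeak ch).l4 = e - c ∧
      ((c < e ∧ (crossWeak ch).l2 ch = 2 * ch.nr + c + e - 2 * ch.nd) ∨
        (c = e ∧ 0 < e ∧ (crossWeak ch).l2 ch = 2 * (ch.nr + ch.ns) - c - 2 * ch.nd) ∨
        (c = e ∧ e = 0 ∧ (crossWeak ch).l2 ch = 2 * ch.nr)) := by
  refine ⟨_, _, rfl, rfl, rfl, rfl, rfl, rfl, ?_⟩
  have hT : (crossWeak ch).T = 2 := rfl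
  have hm : (crossWeak ch).Rcm = 0 := rfl
  have hp1 : (crossWeak ch).Rp1 = 2 * (ch.ns - ch.nc) - (crossWeak ch).Rcn := rfl
  have hp2 : (crossWeak ch).Rp2 = 2 * (ch.nd - ch.ns) := rfl
  have hf : (crossWeak ch).Rcf = min ch.nc (2 * (ch.nr + ch.ns - ch.nd)) := rfl
  have hn : (crossWeak ch).Rcn = min (crossWeak ch).Rcf (2 * (ch.ns - ch.nc)) := rfl
  have h1 : (crossWeak ch).l1 ch = 2 * ch.nc - (crossWeak ch).Rcn - (crossWeak ch).Rcf := by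
    simp only [l1, hT, hm]
    omega
  refine ⟨h1, ?_, rfl, ?_⟩
  · rw [l3]
    by_cases c1 : 0 < (crossWeak ch).l4
    · rw [if_pos c1]
      rw [l4] at c1
      omega
    · rw [if_neg c1]
  · simp only [l2, l4, hT, hm, h1]
    split_ifs with c1 c2
    · left; omega
    · right; left; omega
    · right; right; omega

theorem crossWeak_feasible (h₁ : ch.nc ≤ ch.ns) (h₂ : ch.nc ≤ ch.nr) (h₄ : ch.ns ≤ ch.nd) :
    (crossWeak ch).Feasible ch := by
  have hT : (crossWeak ch).T = 2 := rfl
  have hm : (crossWeak ch).Rcm = 0 := rfl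
  obtain ⟨e, c, hf, hn, he, hc, hp1, hp2, hl1, hl3, hl4, hl2⟩ := crossWeak_lengths h₁ h₄
  constructor <;> (try simp only [l5, l6, hT, hm, hf, hn, hp1, hp2, hl1, hl3, hl4]) <;> omega

/-- If `c = e > 0`, the relay's CF sum lands exactly on the new CN signal, on levels `2 ns - c` to
`2 ns`. If `c < e`, then `Rp1 = 0` and it lies in the contiguous stretch of zero and new CN levels
that ends at `2 ns`. The bound `e ≤ 2 (nr + ns - nd)⁺` makes it fit below the top level that the
relay reaches. -/
theorem crossWeak_decodable (h₁ : ch.nc ≤ ch.ns) (h₂ : ch.nc ≤ ch.nr) (h₃ : ch.nr ≤ ch.nd)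
    (h₄ : ch.ns ≤ ch.nd) (h : ch.nc < ch.nd) : (crossWeak ch).Decodable ch := by
  have hT : (crossWeak ch).T = 2 := rfl
  obtain ⟨e, c, hf, hn, he, hc, hp1, hp2, hl1, hl3, -, hl2⟩ := crossWeak_lengths h₁ h₄
  refine ⟨h, h₂, h₃, h₄, two_pos, rfl, hl3, ?_, ?_, ?_, ?_, ?_⟩ <;>
    simp only [hT, hf, hn, hp1, hp2, hl1] <;> omega

theorem commonOnly_feasible (h₁ : ch.nc = ch.nd) (h₂ : ch.nr = ch.nd) (h₃ : ch.ns = ch.nd) :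
    (commonOnly ch).Feasible ch := by
  have hl1 : (commonOnly ch).l1 ch = 0 := by simp [l1, commonOnly]
  have hl2 : (commonOnly ch).l2 ch = 2 * ch.nr := by simp [l2, l4, commonOnly]
  have hl3 : (commonOnly ch).l3 = 0 := by simp [l3, l4, commonOnly]
  have hl4 : (commonOnly ch).l4 = 0 := by simp [l4, commonOnly]
  constructor <;> (try rw [hl1]) <;> (try rw [hl2, hl3]) <;> (try rw [hl4]) <;>
    simp only [l5, l6, commonOnly] <;> omega

theorem crossWeak_rate (h₁ : ch.nc ≤ ch.ns) (h₂ : ch.ns ≤ ch.nd) :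
    (((crossWeak ch).Rcn + (crossWeak ch).Rcf + (crossWeak ch).Rp1 + (crossWeak ch).Rp2 : ℕ) : ℤ) =
      ch.wi2SumRate := by
  simp only [crossWeak, wi2SumRate]
  omega

/-! ### Equal strengths: sharing the levels with common signals -/

/-- The common signals that carry given message bits from position `a` on. -/
def commonSignals {M N : ℕ} (a : ℕ) (b : Fin M → ℕ → ℕ → ZMod 2)
    (hb : ∀ w k, N ≤ k + 1 → b w k = 0) (hM : M ≤ 2 ^ (N * (commonOnly ch).commonRate ch)) :
    (commonOnly ch).Signals ch M N where
  Mcm := M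
  Mcm_le := hM
  common := id
  ucm w k j := if a ≤ j.val then b w k (j.val - a) else 0
  ucn _ _ := 0
  ucf _ _ := 0
  up1 _ _ := 0
  up2 _ _ := 0
  ucm_last w k hk := by funext j; rw [hb w k hk]; exact ite_self _
  ucn_last _ _ _ := rfl
  ucf_last _ _ _ := rfl
  up1_last _ _ _ := rfl
  up2_last _ _ _ := rfl

theorem commonOnly_blockOutput (h₁ : ch.nc = ch.nd) (h₂ : ch.nr = ch.nd) (h₃ : ch.ns = ch.nd)
    {M₁ M₂ N : ℕ} (s₁ : (commonOnly ch).Signals ch M₁ N) (s₂ : (commonOnly ch).Signals ch M₂ N)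
    (w₁ : Fin M₁) (w₂ : Fin M₂) (k : ℕ) {p : ℕ} (hp : p < 2 * ch.nd) :
    blockOutput s₁ s₂ w₁ w₂ k p = s₁.ucm (s₁.common w₁) k ⟨p, hp⟩ +
      s₂.ucm (s₂.common w₂) k ⟨p, hp⟩ := by
  have hq := q_eq_nd h₁.le h₂.le h₃.le
  have hp' : p < 2 * (commonOnly ch).Rcm := hp
  have l3 : (commonOnly ch).l3 = 0 := by simp [WI2Params.l3, l4, commonOnly]
  have l6 : (commonOnly ch).l6 ch = 0 := by simp [WI2Params.l6, commonOnly]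
  have f : (commonOnly ch).Rcf = 0 := rfl
  simp only [blockOutput, hq, h₁, h₂, Nat.sub_self, Nat.mul_zero, shiftDown, Nat.zero_le, if_true,
    Nat.sub_zero, bits_relayCN, bits_relayCF _ _ _ _ _ _ l3, l6, f, Nat.add_zero]
  rw [if_neg (by omega), if_neg (by omega), Signals.bits_txVector, Signals.bits_txVector,
    if_pos hp', if_pos hp', bits_ofFn_of_lt _ hp', bits_ofFn_of_lt _ hp', add_zero, add_zero]

theorem commonOnly_commonRate (h₁ : ch.nc = ch.nd) : (commonOnly ch).commonRate ch = ch.nd := by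
  simp only [commonRate, commonOnly]
  omega

theorem commonOnly_achieves (h₁ : ch.nc = ch.nd) (h₂ : ch.nr = ch.nd) (h₃ : ch.ns = ch.nd) :
    ch.WI2Achieves (commonOnly ch) (2 * (ch.nd : ℝ) / (commonOnly ch).T) := by
  refine wi2Achieves_of_noError (commonOnly_feasible h₁ h₂ h₃) _ fun n M hM hMB => ?_
  obtain ⟨b, hlast, hzero, hinj⟩ := exists_messageBits hMB
  have hM' : M ≤ 2 ^ (n / (commonOnly ch).T * (commonOnly ch).commonRate ch) := by
    rw [commonOnly_commonRate h₁]
    exact hMB.trans (Nat.pow_le_pow_right two_pos (Nat.mul_le_mul_right _ (Nat.sub_le _ _)))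
  have hq := q_eq_nd h₁.le h₂.le h₃.le
  have key : ∀ w₁ w₂ w₁' w₂' : Fin M, (∀ k < n / (commonOnly ch).T, ∀ p < 2 * ch.nd,
      (if p < ch.nd then b w₁ k p else b w₂ k (p - ch.nd)) =
        if p < ch.nd then b w₁' k p else b w₂' k (p - ch.nd)) → w₁ = w₁' ∧ w₂ = w₂' := by
    intro w₁ w₂ w₁' w₂' h
    refine ⟨hinj _ _ fun k hk j hj => ?_, hinj _ _ fun k hk j hj => ?_⟩
    · simpa only [if_pos hj] using h k hk j (by omega)
    · simpa only [if_neg (Nat.not_lt.2 (Nat.le_add_right ch.nd j)), Nat.add_sub_cancel_left]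
        using h k hk (ch.nd + j) (by omega)
  let s₁ : (commonOnly ch).Signals ch M (n / (commonOnly ch).T) := commonSignals 0 b hlast hM'
  -- The offset `nd` puts the bits of user 2 on the lower half of the `2 * nd` levels, disjoint from
  -- those of user 1.
  let s₂ : (commonOnly ch).Signals ch M (n / (commonOnly ch).T) :=
    commonSignals ch.nd b hlast hM'
  have hsum : ∀ (w₁ w₂ : Fin M) (k : ℕ) {p : ℕ} (hp : p < 2 * ch.nd),
      s₁.ucm (s₁.common w₁) k ⟨p, hp⟩ + s₂.ucm (s₂.common w₂) k ⟨p, hp⟩ =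
        if p < ch.nd then b w₁ k p else b w₂ k (p - ch.nd) := by
    intro w₁ w₂ k p hp
    simp only [s₁, s₂, commonSignals, id, Nat.zero_le, if_true, Nat.sub_zero]
    split_ifs with h1 h2 h2
    · omega
    · rw [hzero w₁ k p h1, zero_add]
    · rw [add_zero]
    · omega
  refine (wi2CodeOfSignals (commonOnly_feasible h₁ h₂ h₃) s₁ s₂ hM hM).exists_noError two_pos hM hM
    (fun w₁ w₂ w₁' w₂' h => key w₁ w₂ w₁' w₂' fun k hk p hp => ?_)
    (fun w₁ w₂ w₁' w₂' h => (key w₁ w₂ w₁' w₂' fun k hk p hp => ?_).symm)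
  · have hY : blockOutput s₁ s₂ w₁ w₂ k p = blockOutput s₁ s₂ w₁' w₂' k p :=
      h k hk p (by rw [hq, Nat.mul_comm]; exact hp)
    rwa [commonOnly_blockOutput h₁ h₂ h₃ _ _ _ _ _ hp,
      commonOnly_blockOutput h₁ h₂ h₃ _ _ _ _ _ hp, hsum, hsum] at hY
  · have hY : blockOutput s₂ s₁ w₂ w₁ k p = blockOutput s₂ s₁ w₂' w₁' k p :=
      h k hk p (by rw [hq, Nat.mul_comm]; exact hp)
    rwa [commonOnly_blockOutput h₁ h₂ h₃ _ _ _ _ _ hp,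
      commonOnly_blockOutput h₁ h₂ h₃ _ _ _ _ _ hp, add_comm, hsum, add_comm, hsum] at hY

end WI2Params

/-! ### Comparison with the upper bounds and conclusion -/

variable {ch : LDIRC}

/-- The last bound equals `2 nd - nc`. The bound with `2 (ns - nc)⁺` equals `2 max (nr + ns - nc)
(nd - nc)`, since `nc ≤ nr` and `nc ≤ ns`. All others are at least `2 nd - nc` whenever they apply.
-/
theorem isLeast_sumCapacityBounds (h₁ : ch.nc ≤ ch.ns) (h₂ : ch.nc ≤ ch.nr) (h₃ : ch.nr ≤ ch.nd)
    (h₄ : ch.ns ≤ ch.nd) : IsLeast ch.sumCapacityBounds ch.wi2SumRate := by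
  constructor
  · simp only [sumCapacityBounds, wi2SumRate, Set.mem_ofPred_eq]
    omega
  · intro b hb
    simp only [sumCapacityBounds, Set.mem_ofPred_eq] at hb
    simp only [wi2SumRate]
    omega

/-- The entry `ns` is dominated by `nr + ns - nc` because `nc ≤ nr`. Apart from the two terms of
`wi2SumRate`, every term is at least `2 nd - nc`. -/
theorem wi2SumRate_eq_sumCapacityExpr (h₁ : ch.nc ≤ ch.ns) (h₂ : ch.nc ≤ ch.nr)
    (h₃ : ch.nr ≤ ch.nd) (h₄ : ch.ns ≤ ch.nd) : ch.wi2SumRate = ch.sumCapacityExpr := by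
  have e1 : max (ch.nd : ℤ) ch.nr = ch.nd := by omega
  have e2 : max (ch.nd : ℤ) ch.nc = ch.nd := by omega
  have e3 : max (ch.nd : ℤ) ch.ns = ch.nd := by omega
  have e4 : max ((ch.ns : ℤ) - ch.nd) 0 = 0 := by omega
  have e5 : max ((ch.nd : ℤ) - ch.nc) 0 = ch.nd - ch.nc := by omega
  have e6 : max ((ch.nc : ℤ) - 0) 0 = ch.nc := by omega
  have e7 : max (ch.ns : ℤ) (max ((ch.nr : ℤ) + ch.ns - ch.nc) (ch.nd - ch.nc)) =
    max ((ch.nr : ℤ) + ch.ns - ch.nc) (ch.nd - ch.nc) := by omega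
  simp only [sumCapacityExpr, wi2SumRate, e1, e2, e3, e4, e5, e6, max_assoc, e7]
  omega

theorem exists_wi2Params (h₁ : ch.nc ≤ ch.ns) (h₂ : ch.nc ≤ ch.nr) (h₃ : ch.nr ≤ ch.nd)
    (h₄ : ch.ns ≤ ch.nd) : ∃ P : WI2Params, P.Feasible ch ∧ P.sumRate ch = (ch.wi2SumRate : ℝ) ∧
      ch.WI2Achieves P (ch.wi2SumRate : ℝ) := by
  rcases h₁.trans h₄ |>.lt_or_eq with h | h
  · have hP := crossWeak_feasible h₁ h₂ h₄
    have hr : ((2 * (((crossWeak ch).Rcn + (crossWeak ch).Rcf + (crossWeak ch).Rp1 +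
        (crossWeak ch).Rp2 : ℕ) : ℝ)) / (crossWeak ch).T : ℝ) = (ch.wi2SumRate : ℝ) := by
      rw [← crossWeak_rate h₁ h₄, Int.cast_natCast]
      exact mul_div_cancel_left₀ _ two_ne_zero
    refine ⟨crossWeak ch, hP, ?_, ?_⟩
    · have h0 : (crossWeak ch).commonRate ch = 0 := Nat.zero_min _
      rw [sumRate, h0, Nat.zero_add, hr]
    · rw [← hr]
      exact (crossWeak_decodable h₁ h₂ h₃ h₄ h).achieves hP
  · have hr' : ch.nr = ch.nd := by omega
    have hs' : ch.ns = ch.nd := by omega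
    have hr : (2 * (ch.nd : ℝ) / (commonOnly ch).T : ℝ) = (ch.wi2SumRate : ℝ) := by
      have : ch.wi2SumRate = ((ch.nd : ℕ) : ℤ) := by simp only [wi2SumRate]; omega
      rw [this, Int.cast_natCast]
      exact mul_div_cancel_left₀ _ two_ne_zero
    refine ⟨commonOnly ch, commonOnly_feasible h hr' hs', ?_, ?_⟩
    · rw [sumRate, commonOnly_commonRate h, ← hr]
      rfl
    · rw [← hr]
      exact commonOnly_achieves h hr' hs'

end LDIRC

theorem mainTheorem7 (ch : LDIRC)
    (h : (ch.nc ≤ ch.ns ∧ ch.ns ≤ ch.nr ∧ ch.nr ≤ ch.nd) ∨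
      (ch.nc ≤ ch.nr ∧ ch.nr ≤ ch.ns ∧ (ch.ns : ℝ) ≤ (ch.nd : ℝ) - (ch.nc : ℝ) / 2)) :
    (∃ P : LDIRC.WI2Params, P.Feasible ch ∧ P.sumRate ch = (ch.wi2SumRate : ℝ) ∧
      ch.WI2Achieves P (ch.wi2SumRate : ℝ)) ∧
    IsLeast ch.sumCapacityBounds ch.wi2SumRate ∧
    (ch.nc < ch.ns →
      ch.wi2SumRate = ch.sumCapacityExpr ∧
      ∀ ε : ℝ, 0 < ε → ∃ R₁ R₂ : ℝ, ch.Achievable R₁ R₂ ∧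
        (ch.sumCapacityExpr : ℝ) - ε < R₁ + R₂) := by
  obtain ⟨h₁, h₂, h₃, h₄⟩ :
      ch.nc ≤ ch.ns ∧ ch.nc ≤ ch.nr ∧ ch.nr ≤ ch.nd ∧ ch.ns ≤ ch.nd := by
    rcases h with h | ⟨ha, hb, hc⟩
    · omega
    · have : (ch.ns : ℝ) ≤ ch.nd := by
        have := Nat.cast_nonneg (α := ℝ) ch.nc
        linarith
      have := Nat.cast_le.1 this
      omega
  have hP := LDIRC.exists_wi2Params h₁ h₂ h₃ h₄
  have hE := LDIRC.wi2SumRate_eq_sumCapacityExpr h₁ h₂ h₃ h₄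
  refine ⟨hP, LDIRC.isLeast_sumCapacityBounds h₁ h₂ h₃ h₄, fun _ => ⟨hE, fun ε hε => ?_⟩⟩
  obtain ⟨P, -, -, hA⟩ := hP
  rw [← hE]
  exact hA.achievable hε
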